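/- **Setting.** All manifolds are connected (Hausdorff, second countable) and smooth. Let $\varepsilon,c\in\{1,-1\}$, let $N\ge 2$ and $0\le\lambda\le N$ be integers, let $I\subset\mathbb{R}$ be an open interval and $a:I\to(0,\infty)$ a smooth function. Put $\mu=\lambda$ if $c=1$ and $\mu=\lambda+1$ if $c=-1$, and let $g_0=\sum_{i=0}^{N-\mu}dx_i^2-\sum_{i=N-\mu+1}^{N}dx_i^2$ on $\mathbb{R}^{N+1}$. Let $\mathbb{M}^N_\lambda(c)$ be one connected component of the hyperquadric $\{p\in\mathbb{R}^{N+1}: g_0(p,p)=c\}$, with the metric $g$ induced by $g_0$. Let $\varepsilon I\times_a\mathbb{M}^N_\lambda(c)$ be the manifold $I\times\mathbb{M}^N_\lambda(c)$ with the semi-Riemannian metric $\langle\,,\rangle=\varepsilon\,dt^2+a(t)^2g$. Let $M^n$ be a semi-Riemannian manifold and $f:M^n\to\varepsilon I\times_a\mathbb{M}^N_\lambda(c)$ an isometric immersion; write $\langle\,,\rangle$ also for the metric of $M$. Let $\nabla$ and $\bar\nabla$ be the Levi-Civita connections of $M$ and of $\varepsilon I\times_a\mathbb{M}^N_\lambda(c)$.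 Let $R(X,Y)Z=\nabla_X\nabla_YZ-\nabla_Y\nabla_XZ-\nabla_{[X,Y]}Z$ and $R(X,Y,Z,W)=\langle R(X,Y)Z,W\rangle$. Let $\alpha(X,Y)$ be the second fundamental form of $f$, that is, the component of $\bar\nabla_X(df(Y))$ normal to $M$. Let $\pi:M\to I$ be the composition of $f$ with the projection to $I$, and let $T=\varepsilon\,\mathrm{grad}(\pi)$, the gradient being taken in $M$ (so $T$ is the tangential part of $\partial_t$). **Proposition 3.2 (Gauss equation for a given immersion).** For all smooth vector fields $X,Y,Z,W$ on $M$, $$ \begin{aligned} R(X,Y,Z,W)={}&\Big(\varepsilon\frac{(a')^2}{a^2}-\frac{c}{a^2}\Big)\Big(\langle X,Z\rangle\langle Y,W\rangle-\langle Y,Z\rangle\langle X,W\rangle\Big)\\ &+\Big(\frac{a''}{a}-\frac{(a')^2}{a^2}+\frac{\varepsilon c}{a^2}\Big)\Big(\langle X,Z\rangle\langle Y,T\rangle\langle W,T\rangle-\langle Y,Z\rangle\langle X,T\rangle\langle W,T\rangle\\ &\qquad-\langle X,W\rangle\langle Y,T\rangle\langle Z,T\rangle+\langle Y,W\rangle\langle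 X,T\rangle\langle Z,T\rangle\Big)\\ &-\langle\alpha(X,Z),\alpha(Y,W)\rangle+\langle\alpha(X,W),\alpha(Y,Z)\rangle \end{aligned} $$ at every point of $M$, where $a,a',a''$ are evaluated at $\pi$ of that point. -/

import Mathlib

open Bundle Manifold
open scoped ContDiff Topology
noncomputable section
namespace SemiRiemannian

/-- A smooth semi-Riemannian metric (of arbitrary signature) on a smooth manifold: a smooth section
of symmetric, nondegenerate bilinear forms on the tangent spaces. -/
structure Metric {E : Type*} [NormedAddCommGroup E] [NormedSpace ℝ E] {H : Type*}
    [TopologicalSpace H] (I : ModelWithCorners ℝ E H) (M : Type*) [TopologicalSpace M]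
    [ChartedSpace H M] [IsManifold I ∞ M] where
  /-- The scalar product on the tangent space at `x`. -/
  val (x : M) : TangentSpace I x →L[ℝ] TangentSpace I x →L[ℝ] ℝ
  symm (x : M) (v w : TangentSpace I x) : val x v w = val x w v
  nondegenerate (x : M) (v : TangentSpace I x) : (∀ w, val x v w = 0) → v = 0
  contMDiff : ContMDiff I (I.prod 𝓘(ℝ, E →L[ℝ] E →L[ℝ] ℝ)) ∞
    (fun x ↦ TotalSpace.mk' (E →L[ℝ] E →L[ℝ] ℝ) x (val x))

variable {E : Type*} [NormedAddCommGroup E] [NormedSpace ℝ E]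
  {H : Type*} [TopologicalSpace H] {I : ModelWithCorners ℝ E H}
  {M : Type*} [TopologicalSpace M] [ChartedSpace H M] [IsManifold I ∞ M]

/-- `D` is a Levi-Civita connection of `g`: it is torsion-free, `D_X Y - D_Y X = [X, Y]`, and
compatible with the metric, `v g(Y, Z) = g(D_v Y, Z) + g(Y, D_v Z)`. Here `D Y x v` is `D_v Y` at `x`. -/
structure IsLeviCivita (g : Metric I M) (D : CovariantDerivative I E (TangentSpace I : M → Type _)) :
    Prop where
  torsion (x : M) (X Y : Π y : M, TangentSpace I y) (hX : MDiffAt (T% X) x) (hY : MDiffAt (T% Y) x) :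
    D Y x (X x) - D X x (Y x) = VectorField.mlieBracket I X Y x
  metric (x : M) (Y Z : Π y : M, TangentSpace I y)
    (hY : MDiffAt (T% Y) x) (hZ : MDiffAt (T% Z) x) (v : TangentSpace I x) :
    mvfderiv I (fun y => g.val y (Y y) (Z y)) x v =
      g.val x (D Y x v) (Z x) + g.val x (Y x) (D Z x v)

section existence

/-- The components of a vector field in the coordinate frame centred at `x`. -/
def coord (x : M) (σ : Π y : M, TangentSpace I y) (y : M) : E :=
  (trivializationAt E (TangentSpace I) x ⟨y, σ y⟩).2

theorem coord_self (x : M) (σ : Π y : M, TangentSpace I y) : coord x σ x = σ x := by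
  have := TangentBundle.continuousLinearMapAt_trivializationAt (I := I) (mem_chart_source H x)
  rw [mfderiv_extChartAt_self] at this
  have h2 := congr($this (σ x))
  rw [Trivialization.continuousLinearMapAt_apply, Trivialization.coe_linearMapAt_of_mem _ (by simp)] at h2
  exact h2

theorem coord_mdiff {x : M} {σ : Π y : M, TangentSpace I y} (h : MDiffAt (T% σ) x) :
    MDifferentiableAt I 𝓘(ℝ, E) (coord x σ) x :=
  (mdifferentiableAt_totalSpace ..).1 h |>.2

theorem coord_add (x : M) (σ τ : Π y : M, TangentSpace I y) :
    coord x (σ + τ) =ᶠ[𝓝 x] coord x σ + coord x τ := by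
  filter_upwards [(trivializationAt E (TangentSpace I) x).open_baseSet.mem_nhds
    (FiberBundle.mem_baseSet_trivializationAt' x)] with y hy
  simp only [coord, Pi.add_apply]
  exact ((trivializationAt E (TangentSpace I) x).linear ℝ hy).map_add _ _

theorem coord_smul (x : M) (f : M → ℝ) (τ : Π y : M, TangentSpace I y) :
    coord x (f • τ) =ᶠ[𝓝 x] f • coord x τ := by
  filter_upwards [(trivializationAt E (TangentSpace I) x).open_baseSet.mem_nhds
    (FiberBundle.mem_baseSet_trivializationAt' x)] with y hy
  simp only [coord, Pi.smul_apply']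
  exact ((trivializationAt E (TangentSpace I) x).linear ℝ hy).map_smul _ _

theorem coord_bracket (x : M) (X Y : Π y : M, TangentSpace I y) (hX : MDiffAt (T% X) x)
    (hY : MDiffAt (T% Y) x) :
    mvfderiv I (coord x Y) x (X x) - mvfderiv I (coord x X) x (Y x)
      = VectorField.mlieBracket I X Y x := by
  have key : ∀ X : Π y : M, TangentSpace I y,
      VectorField.mpullbackWithin 𝓘(ℝ, E) I (extChartAt I x).symm X (Set.range I)
      =ᶠ[𝓝[Set.range I] (extChartAt I x x)] coord x X ∘ (extChartAt I x).symm := by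
    intro X
    filter_upwards [extChartAt_target_mem_nhdsWithin x] with y hy
    have hs : (extChartAt I x).symm y ∈ (chartAt H x).source := by
      rw [← extChartAt_source I]; exact (extChartAt I x).map_target hy
    have h1 := TangentBundle.continuousLinearMapAt_trivializationAt (I := I) hs
    have h2 := mfderiv_extChartAt_comp_mfderivWithin_extChartAt_symm (I := I) hy
    have h3 := mfderivWithin_extChartAt_symm_comp_mfderiv_extChartAt (I := I) hy
    simp only [VectorField.mpullbackWithin, Function.comp, coord]
    rw [ContinuousLinearMap.inverse_eq h3 h2, ← h1]
    erw [Trivialization.continuousLinearMapAt_apply]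
    rw [Trivialization.coe_linearMapAt_of_mem _ (by simpa using hs)]
  have key2 : ∀ X : Π y : M, TangentSpace I y, MDiffAt (T% X) x →
     fderivWithin ℝ (VectorField.mpullbackWithin 𝓘(ℝ, E) I (extChartAt I x).symm X (Set.range I))
       (Set.range I) (extChartAt I x x) = mvfderiv I (coord x X) x := by
    intro X hX
    rw [(key X).fderivWithin_eq ((key X).self_of_nhdsWithin (Set.mem_range_self _)), mvfderiv, (coord_mdiff hX).mfderiv]
    rfl
  have key3 : ∀ X : Π y : M, TangentSpace I y,
     (VectorField.mpullbackWithin 𝓘(ℝ, E) I (extChartAt I x).symm X (Set.range I))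
        (extChartAt I x x) = X x := by
    intro X
    rw [(key X).self_of_nhdsWithin (Set.mem_range_self _)]
    simp only [Function.comp, extChartAt_to_inv]
    exact coord_self x X
  rw [← VectorField.mlieBracketWithin_univ, VectorField.mlieBracketWithin_apply,
    mfderiv_extChartAt_self]
  simp only [VectorField.lieBracketWithin, Set.preimage_univ, Set.univ_inter, key2 X hX, key2 Y hY, key3]
  exact (congrArg (fun T : E →L[ℝ] E => T (mvfderiv I (coord x Y) x (X x) -
    mvfderiv I (coord x X) x (Y x))) (ContinuousLinearMap.inverse_id (R := ℝ) (M := E))).symm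

theorem mvfderiv_bilin {V : Type*} [NormedAddCommGroup V] [NormedSpace ℝ V] {x : M}
    {G : M → V →L[ℝ] V →L[ℝ] ℝ} {a b : M → V}
    (hG : MDifferentiableAt I 𝓘(ℝ, V →L[ℝ] V →L[ℝ] ℝ) G x) (ha : MDifferentiableAt I 𝓘(ℝ, V) a x)
    (hb : MDifferentiableAt I 𝓘(ℝ, V) b x) (v : TangentSpace I x) :
    mvfderiv I (fun y => G y (a y) (b y)) x v = mvfderiv I G x v (a x) (b x) +
      G x (mvfderiv I a x v) (b x) + G x (a x) (mvfderiv I b x v) := by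
  rw [(hG.clm_apply ha |>.clm_apply hb).mvfderiv, hG.mvfderiv, ha.mvfderiv, hb.mvfderiv]
  have hG' := hG.differentiableWithinAt_writtenInExtChartAt.hasFDerivWithinAt
  have ha' := ha.differentiableWithinAt_writtenInExtChartAt.hasFDerivWithinAt
  have hb' := hb.differentiableWithinAt_writtenInExtChartAt.hasFDerivWithinAt
  have h2 := ((hG'.clm_apply ha').clm_apply hb').fderivWithin
    (I.uniqueDiffOn _ (Set.mem_range_self _))
  refine (congrArg (fun T : E →L[ℝ] ℝ => T v) h2).trans ?_
  have e1 : writtenInExtChartAt I 𝓘(ℝ, V →L[ℝ] V →L[ℝ] ℝ) x G (extChartAt I x x) = G x := by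
    simp [writtenInExtChartAt]; rfl
  have e2 : writtenInExtChartAt I 𝓘(ℝ, V) x a (extChartAt I x x) = a x := by
    simp [writtenInExtChartAt]; rfl
  have e3 : writtenInExtChartAt I 𝓘(ℝ, V) x b (extChartAt I x x) = b x := by
    simp [writtenInExtChartAt]; rfl
  rw [e1, e2, e3]
  generalize fderivWithin ℝ (writtenInExtChartAt I 𝓘(ℝ, V →L[ℝ] V →L[ℝ] ℝ) x G) (Set.range ↑I)
    (extChartAt I x x) = P
  generalize fderivWithin ℝ (writtenInExtChartAt I 𝓘(ℝ, V) x a) (Set.range ↑I)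
    (extChartAt I x x) = Q
  generalize fderivWithin ℝ (writtenInExtChartAt I 𝓘(ℝ, V) x b) (Set.range ↑I)
    (extChartAt I x x) = R
  change G x (a x) (R v) + (G x (Q v) (b x) + P v (a x) (b x)) =
    P v (a x) (b x) + G x (Q v) (b x) + G x (a x) (R v)
  ring

theorem mvfderiv_congr {F : Type*} [NormedAddCommGroup F] [NormedSpace ℝ F] {x : M} {a b : M → F}
    (h : a =ᶠ[𝓝 x] b) : mvfderiv I a x = mvfderiv I b x := by
  ext v
  simp only [mvfderiv, h.mfderiv_eq, ContinuousLinearMap.comp_apply]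
  rfl


theorem christoffel {E : Type*} [NormedAddCommGroup E] [NormedSpace ℝ E] [FiniteDimensional ℝ E]
    (G : E →L[ℝ] E →L[ℝ] ℝ) (hG : ∀ u v, G u v = G v u) (hn : ∀ u, (∀ v, G u v = 0) → u = 0)
    (D : E →L[ℝ] E →L[ℝ] E →L[ℝ] ℝ) (hD : ∀ v u w, D v u w = D v w u) :
    ∃ Γ : E →L[ℝ] E →L[ℝ] E, (∀ u v, Γ u v = Γ v u) ∧
      ∀ u v w, D v u w = G (Γ u v) w + G u (Γ w v) := by
  have hinj : Function.Injective (G : E →ₗ[ℝ] E →L[ℝ] ℝ) := by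
    rw [← LinearMap.ker_eq_bot, LinearMap.ker_eq_bot']
    exact fun u hu => hn u fun v => congr($hu v)
  have hdim : Module.finrank ℝ E = Module.finrank ℝ (E →L[ℝ] ℝ) := by
    rw [← Subspace.dual_finrank_eq (K := ℝ) (V := E)]
    exact (LinearMap.toContinuousLinearMap (𝕜 := ℝ) (E := E) (F' := ℝ)).finrank_eq
  let S : (E →L[ℝ] ℝ) →L[ℝ] E := LinearMap.toContinuousLinearMap
    (LinearMap.linearEquivOfInjective (G : E →ₗ[ℝ] E →L[ℝ] ℝ) hinj hdim).symm.toLinearMap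
  have hS (φ : E →L[ℝ] ℝ) (w : E) : G (S φ) w = φ w :=
    congr($((LinearMap.linearEquivOfInjective
      (G : E →ₗ[ℝ] E →L[ℝ] ℝ) hinj hdim).apply_symm_apply φ) w)
  let B : E →L[ℝ] E →L[ℝ] E →L[ℝ] ℝ := (2⁻¹ : ℝ) • (D.flip + D -
    (ContinuousLinearMap.flipₗᵢ ℝ E E ℝ : (E →L[ℝ] E →L[ℝ] ℝ) →L[ℝ] (E →L[ℝ] E →L[ℝ] ℝ)) ∘L D.flip)
  have hB (u v w : E) : B u v w = 2⁻¹ * (D v u w + D u v w - D w u v) := rfl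
  have hΓ (u v w : E) : G (((ContinuousLinearMap.compL ℝ E (E →L[ℝ] ℝ) E S) ∘L B) u v) w =
      2⁻¹ * (D v u w + D u v w - D w u v) := hS (B u v) w
  refine ⟨(ContinuousLinearMap.compL ℝ E (E →L[ℝ] ℝ) E S) ∘L B, fun u v => ?_, fun u v w => ?_⟩
  · rw [← sub_eq_zero]
    refine hn _ fun w => ?_
    rw [map_sub, sub_apply, hΓ, hΓ, hD w u v]
    ring
  · rw [hG u, hΓ, hΓ, hD v w u, hD u w v, hD w v u]
    ring

/-- Every semi-Riemannian metric on a finite-dimensional manifold has a Levi-Civita connection. -/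
theorem exists_leviCivita [FiniteDimensional ℝ E] (g : Metric I M) : ∃ D, IsLeviCivita g D := by
  classical
  let tr (x : M) := trivializationAt E (TangentSpace I : M → Type _) x
  let gc (x : M) (y : M) : E →L[ℝ] E →L[ℝ] ℝ :=
    ContinuousLinearMap.inCoordinates E (TangentSpace I : M → Type _) (E →L[ℝ] ℝ)
      (fun x : M => TangentSpace I x →L[ℝ] ℝ) x y x y (g.val y)
  have hgd (x : M) : MDifferentiableAt I 𝓘(ℝ, E →L[ℝ] E →L[ℝ] ℝ) (gc x) x := by
    have h := (g.contMDiff x).mdifferentiableAt (by simp)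
    exact ((mdifferentiableAt_hom_bundle _).1 h).2
  have hbase (x : M) : ∀ᶠ y in 𝓝 x, y ∈ (tr x).baseSet := (tr x).open_baseSet.mem_nhds
      (FiberBundle.mem_baseSet_trivializationAt' x)
  have hgc (x y : M) (hy : y ∈ (tr x).baseSet) (u v : E) :
      gc x y u v = g.val y ((tr x).symm y u) ((tr x).symm y v) := by
    have := inCoordinates_apply_eq₂ (E₃ := Bundle.Trivial M ℝ) (F₃ := ℝ) (ϕ := g.val y) (v := u)
      (w := v) hy hy (by trivial)
    simpa using this
  have hg (x : M) (X Y : Π y : M, TangentSpace I y) :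
      (fun y => g.val y (X y) (Y y)) =ᶠ[𝓝 x] fun y => gc x y (coord x X y) (coord x Y y) := by
    filter_upwards [hbase x] with y hy
    rw [hgc x y hy]
    simp only [coord]
    rw [(tr x).symm_apply_apply_mk hy, (tr x).symm_apply_apply_mk hy]
  have hgx (x : M) (u v : TangentSpace I x) : gc x x u v = g.val x u v := by
    have := (hg x (FiberBundle.extend E u) (FiberBundle.extend E v)).self_of_nhds
    simp only [coord_self, FiberBundle.extend_apply_self] at this
    exact this.symm
  let Dg (x : M) : E →L[ℝ] E →L[ℝ] E →L[ℝ] ℝ := mvfderiv I (gc x) x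
  have hsymm (x : M) (v u w : E) : Dg x v u w = Dg x v w u := by
    have h1 := mvfderiv_bilin (hgd x) (mdifferentiableAt_const (c := u)) (mdifferentiableAt_const (c := w)) v
    have h2 := mvfderiv_bilin (hgd x) (mdifferentiableAt_const (c := w)) (mdifferentiableAt_const (c := u)) v
    have h3 : (fun y => gc x y u w) =ᶠ[𝓝 x] fun y => gc x y w u := by
      filter_upwards [hbase x] with y hy
      rw [hgc x y hy, hgc x y hy, g.symm]
    rw [mvfderiv_congr h3, h2] at h1
    have e0 (c : E) : mvfderiv I (fun _ : M => c) x v = 0 := by rw [mvfderiv_const]; rfl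
    simp only [e0, map_zero, _root_.zero_apply, add_zero] at h1
    exact h1.symm
  have hsy (x : M) (u v : E) : gc x x u v = gc x x v u :=
    (hgx x u v).trans ((g.symm x u v).trans (hgx x v u).symm)
  have hnd (x : M) (u : E) (h : ∀ v, gc x x u v = 0) : u = 0 :=
    g.nondegenerate x u fun w => (hgx x u w).symm.trans (h w)
  choose Γ hΓs hΓ using fun x => christoffel (gc x x) (hsy x) (hnd x) (Dg x) (hsymm x)
  let dc (X : Π y : M, TangentSpace I y) (x : M) : E →L[ℝ] E := mvfderiv I (coord x X) x
  let C (X : Π y : M, TangentSpace I y) (x : M) : E →L[ℝ] E := dc X x + Γ x (X x)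
  have hC (X : Π y : M, TangentSpace I y) (x : M) (v a : E) (ha : X x = a) :
      C X x v = dc X x v + Γ x a v := by rw [← ha]; rfl
  refine ⟨⟨C, ⟨?_, ?_⟩⟩, ⟨?_, ?_⟩⟩
  · intro X Y x hX hY _
    refine ContinuousLinearMap.ext fun (v : E) => ?_
    change C (X + Y) x v = C X x v + C Y x v
    have h1 : dc (X + Y) x v = dc X x v + dc Y x v := by
      simp only [dc]
      rw [mvfderiv_congr (coord_add x X Y), mvfderiv_add (coord_mdiff hX) (coord_mdiff hY)]
      rfl
    obtain ⟨a, ha⟩ : ∃ a : E, X x = a := ⟨_, rfl⟩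
    obtain ⟨b, hb⟩ : ∃ a : E, Y x = a := ⟨_, rfl⟩
    have hab : (X + Y) x = (a + b : E) := by rw [← ha, ← hb]; rfl
    rw [hC _ x v _ hab, hC _ x v _ ha, hC _ x v _ hb, h1, map_add, add_apply]
    abel
  · intro X f x hX hf _
    refine ContinuousLinearMap.ext fun (v : E) => ?_
    obtain ⟨a, ha⟩ : ∃ a : E, X x = a := ⟨_, rfl⟩
    obtain ⟨d, hd⟩ : ∃ d : ℝ, mvfderiv I f x v = d := ⟨_, rfl⟩
    have hab : (f • X) x = (f x • a : E) := by rw [← ha]; rfl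
    have h1 : dc (f • X) x v = f x • dc X x v + d • a := by
      simp only [dc]
      rw [mvfderiv_congr (coord_smul x f X), mvfderiv_smul hf (coord_mdiff hX), coord_self, ← ha,
        ← hd]
      rfl
    have : C (f • X) x v = f x • C X x v + d • a := by
      rw [hC _ x v _ hab, hC _ x v _ ha, h1, map_smul, smul_apply]
      module
    refine this.trans ?_
    rw [← hd, ← ha]
    rfl
  · intro x X Y hX hY
    refine Eq.trans ?_ (coord_bracket x X Y hX hY)
    obtain ⟨a, ha⟩ : ∃ a : E, X x = a := ⟨_, rfl⟩
    obtain ⟨b, hb⟩ : ∃ a : E, Y x = a := ⟨_, rfl⟩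
    rw [ha, hb]
    change C Y x a - C X x b = dc Y x a - dc X x b
    rw [hC _ x _ _ ha, hC _ x _ _ hb, hΓs x b a]
    abel
  · intro x Y Z hY hZ v
    obtain ⟨a, ha⟩ : ∃ a : E, Y x = a := ⟨_, rfl⟩
    obtain ⟨b, hb⟩ : ∃ a : E, Z x = a := ⟨_, rfl⟩
    obtain ⟨w, hw⟩ : ∃ w : E, v = w := ⟨_, rfl⟩
    rw [mvfderiv_congr (hg x Y Z), mvfderiv_bilin (hgd x) (coord_mdiff hY) (coord_mdiff hZ),
      coord_self, coord_self, ← hgx, ← hgx, ha, hb, hw]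
    change Dg x w a b + gc x x (dc Y x w) b + gc x x a (dc Z x w) =
      gc x x (C Y x w) b + gc x x a (C Z x w)
    rw [hC _ x _ _ ha, hC _ x _ _ hb, hΓ x a w b, map_add, map_add, add_apply]
    ring

end existence



/-- The signs of the flat metric of index `μ` on `ℝ^(N+1)`: plus for `i = 0, …, N - μ`, minus for the
remaining `μ` indices. -/
def signature (N μ : ℕ) (i : Fin (N + 1)) : ℝ := if (i : ℕ) + μ ≤ N then 1 else -1

theorem signature_mul_self (N μ : ℕ) (i : Fin (N + 1)) :
    signature N μ i * signature N μ i = 1 := by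
  unfold signature; split_ifs <;> norm_num

/-- The flat metric `g₀ = ∑ ± dx_i²` of index `μ` on `ℝ^(N+1)`, as a bilinear form. -/
def pseudoForm (N μ : ℕ) : (Fin (N + 1) → ℝ) →L[ℝ] (Fin (N + 1) → ℝ) →L[ℝ] ℝ :=
  ∑ i, signature N μ i • (ContinuousLinearMap.proj (R := ℝ) (φ := fun _ : Fin (N + 1) => ℝ) i).smulRight
    (ContinuousLinearMap.proj (R := ℝ) (φ := fun _ : Fin (N + 1) => ℝ) i)

theorem pseudoForm_apply (N μ : ℕ) (x y : Fin (N + 1) → ℝ) :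
    pseudoForm N μ x y = ∑ i, signature N μ i * (x i * y i) := by
  simp [pseudoForm, sum_apply]

/-- The index of the flat space that contains the space form of index `l` and curvature `c = ± 1`:
`l` for `c = 1` (pseudo-sphere) and `l + 1` for `c = -1` (pseudo-hyperbolic space). -/
def ambientIndex (l : ℕ) (c : ℤˣ) : ℕ := if c = 1 then l else l + 1

/-- The hyperquadric `{p | g₀(p, p) = c}` in `ℝ^(N+1)`. -/
def hyperquadric (N l : ℕ) (c : ℤˣ) : Set (Fin (N + 1) → ℝ) :=
  {p | pseudoForm N (ambientIndex l c) p p = ((c : ℤ) : ℝ)}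

theorem unit_ne_zero (c : ℤˣ) : ((c : ℤ) : ℝ) ≠ 0 := by
  rcases Int.units_eq_one_or c with rfl | rfl <;> norm_num

section charts

variable {N l : ℕ} {c : ℤˣ}

theorem hyperquadric_ne (p : hyperquadric N l c) : ∃ i, p.1 i ≠ 0 := by
  by_contra! h
  have := p.2
  simp only [hyperquadric, Set.mem_ofPred_eq, pseudoForm_apply, h] at this
  exact unit_ne_zero c (by simpa using this.symm)

/-- The index of a nonzero coordinate of `p`. -/
def pivot (p : hyperquadric N l c) : Fin (N + 1) := (hyperquadric_ne p).choose

theorem pivot_ne (p : hyperquadric N l c) : p.1 (pivot p) ≠ 0 := (hyperquadric_ne p).choose_spec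

/-- On the hyperquadric, the square of the `i`-th coordinate as a function of the other ones. -/
def rad (l : ℕ) (c : ℤˣ) (i : Fin (N + 1)) (y : Fin N → ℝ) : ℝ :=
  signature N (ambientIndex l c) i *
    (c - ∑ j, signature N (ambientIndex l c) (i.succAbove j) * (y j * y j))

theorem mem_hyperquadric_iff (i : Fin (N + 1)) (x : Fin (N + 1) → ℝ) :
    x ∈ hyperquadric N l c ↔ x i * x i = rad l c i (fun j => x (i.succAbove j)) := by
  simp only [hyperquadric, Set.mem_ofPred_eq, pseudoForm_apply, Fin.sum_univ_succAbove _ i, rad]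
  have := signature_mul_self N (ambientIndex l c) i
  constructor
  · intro h
    rw [← h]
    linear_combination (-(x i * x i)) * this
  · intro h
    rw [h]
    linear_combination (c - ∑ j, signature N (ambientIndex l c) (i.succAbove j) *
      (x (i.succAbove j) * x (i.succAbove j))) * this

theorem continuous_rad (i : Fin (N + 1)) : Continuous (rad (N := N) l c i) := by
  unfold rad; fun_prop

/-- The hyperquadric near `p` as a graph over the coordinates other than `pivot p`. -/
def graphMap (p : hyperquadric N l c) (y : Fin N → ℝ) : Fin (N + 1) → ℝ :=
  (pivot p).insertNth (p.1 (pivot p) / |p.1 (pivot p)| * √(rad l c (pivot p) y)) y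

theorem graphMap_mem (p : hyperquadric N l c) {y : Fin N → ℝ} (hy : 0 < rad l c (pivot p) y) :
    graphMap p y ∈ hyperquadric N l c := by
  rw [mem_hyperquadric_iff (pivot p)]
  simp only [graphMap, Fin.insertNth_apply_same, Fin.insertNth_apply_succAbove]
  have h1 := Real.mul_self_sqrt hy.le
  have h2 : |p.1 (pivot p)| ≠ 0 := abs_ne_zero.2 (pivot_ne p)
  have h3 := abs_mul_abs_self (p.1 (pivot p))
  field_simp
  simp only [pow_two, h1, h3]

open Classical in
/-- The graph chart at `p`: on the part of the hyperquadric where the coordinate `pivot p` has the same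
sign as at `p`, forget that coordinate. -/
def quadricChart (p : hyperquadric N l c) :
    OpenPartialHomeomorph (hyperquadric N l c) (Fin N → ℝ) where
  toFun q j := q.1 ((pivot p).succAbove j)
  invFun y := if h : 0 < rad l c (pivot p) y then ⟨graphMap p y, graphMap_mem p h⟩ else p
  source := {q | 0 < p.1 (pivot p) * q.1 (pivot p)}
  target := {y | 0 < rad l c (pivot p) y}
  map_source' q hq := by
    rw [Set.mem_ofPred_eq] at hq ⊢
    rw [← (mem_hyperquadric_iff (pivot p) q.1).1 q.2]
    exact mul_self_pos.2 (right_ne_zero_of_mul hq.ne')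
  map_target' y hy := by
    rw [Set.mem_ofPred_eq] at hy
    simp only [hy, dite_true, Set.mem_ofPred_eq, graphMap, Fin.insertNth_apply_same]
    have h2 : 0 < |p.1 (pivot p)| := abs_pos.2 (pivot_ne p)
    have h3 := Real.sqrt_pos.2 hy
    have h4 : 0 < p.1 (pivot p) * p.1 (pivot p) := mul_self_pos.2 (pivot_ne p)
    have : p.1 (pivot p) * (p.1 (pivot p) / |p.1 (pivot p)| * √(rad l c (pivot p) y)) =
      (p.1 (pivot p) * p.1 (pivot p)) / |p.1 (pivot p)| * √(rad l c (pivot p) y) := by ring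
    rw [this]
    positivity
  left_inv' q hq := by
    rw [Set.mem_ofPred_eq] at hq
    have h1 := (mem_hyperquadric_iff (pivot p) q.1).1 q.2
    have h0 : 0 < rad l c (pivot p) (fun j => q.1 ((pivot p).succAbove j)) := by
      rw [← h1]; exact mul_self_pos.2 (right_ne_zero_of_mul hq.ne')
    simp only [h0, dite_true]
    apply Subtype.ext
    funext k
    simp only [graphMap]
    refine Fin.succAboveCases (pivot p) ?_ (fun j => ?_) k
    · rw [Fin.insertNth_apply_same, ← h1, Real.sqrt_mul_self_eq_abs]
      rcases lt_trichotomy (p.1 (pivot p)) 0 with h | h | h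
      · have : q.1 (pivot p) < 0 := by
          by_contra! h'; exact absurd hq (not_lt.2 (mul_nonpos_of_nonpos_of_nonneg h.le h'))
        rw [abs_of_neg h, abs_of_neg this]; field_simp [h.ne]
      · exact absurd h (pivot_ne p)
      · have := (pos_iff_pos_of_mul_pos hq).1 h
        rw [abs_of_pos h, abs_of_pos this]; field_simp [h.ne']
    · rw [Fin.insertNth_apply_succAbove]
  right_inv' y hy := by
    rw [Set.mem_ofPred_eq] at hy
    simp only [hy, dite_true, graphMap, Fin.insertNth_apply_succAbove]
  open_source := by
    refine isOpen_lt continuous_const (continuous_const.mul ?_)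
    exact (continuous_apply _).comp continuous_subtype_val
  open_target := isOpen_lt continuous_const (continuous_rad _)
  continuousOn_toFun := Continuous.continuousOn <|
    continuous_pi fun _ => (continuous_apply _).comp continuous_subtype_val
  continuousOn_invFun := by
    rw [Topology.IsInducing.subtypeVal.continuousOn_iff]
    have : ContinuousOn (graphMap p) {y | 0 < rad l c (pivot p) y} := by
      refine Continuous.continuousOn ?_
      unfold graphMap
      have := continuous_rad (l := l) (c := c) (pivot p)
      fun_prop
    refine this.congr fun y hy => ?_
    rw [Set.mem_ofPred_eq] at hy
    simp [hy]

/-- The manifold structure on the hyperquadric, as a hypersurface of `ℝ^(N+1)`, by graph charts. -/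
instance : ChartedSpace (Fin N → ℝ) (hyperquadric N l c) where
  atlas := Set.range quadricChart
  chartAt := quadricChart
  mem_chart_source p := mul_self_pos.2 (pivot_ne p)
  chart_mem_atlas p := ⟨p, rfl⟩

theorem contDiffOn_graphMap (p : hyperquadric N l c) :
    ContDiffOn ℝ ∞ (graphMap p) (quadricChart p).target := by
  rw [contDiffOn_pi]
  intro k
  unfold graphMap
  refine Fin.succAboveCases (pivot p) ?_ (fun j => ?_) k
  · simp only [Fin.insertNth_apply_same]
    refine contDiffOn_const.mul (ContDiffOn.sqrt ?_ fun y hy => ne_of_gt hy)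
    unfold rad
    fun_prop
  · simp only [Fin.insertNth_apply_succAbove]
    fun_prop

theorem quadricChart_symm (p : hyperquadric N l c) {y : Fin N → ℝ} (hy : y ∈ (quadricChart p).target) :
    ((quadricChart p).symm y).1 = graphMap p y := by
  have : 0 < rad l c (pivot p) y := hy
  change (Subtype.val (dite _ _ _)) = _
  simp [this]

instance : IsManifold 𝓘(ℝ, Fin N → ℝ) ∞ (hyperquadric N l c) := by
  refine isManifold_of_contDiffOn _ _ _ ?_
  rintro _ _ ⟨p, rfl⟩ ⟨q, rfl⟩
  have h : ContDiffOn ℝ ∞ (fun y j => graphMap p y ((pivot q).succAbove j))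
      (quadricChart p).target := by
    have := contDiffOn_pi.1 (contDiffOn_graphMap p)
    exact contDiffOn_pi.2 fun j => this _
  refine (h.mono ?_).congr ?_
  · intro y hy
    simp at hy
    exact hy.1
  · intro y hy
    simp at hy
    simp only [Function.comp, modelWithCornersSelf_coe, modelWithCornersSelf_coe_symm, id,
      OpenPartialHomeomorph.coe_trans]
    funext j
    change ((quadricChart p).symm y).1 _ = _
    rw [quadricChart_symm p hy.1]

theorem contMDiff_coe_hyperquadric :
   ContMDiff 𝓘(ℝ, Fin N → ℝ) 𝓘(ℝ, Fin (N + 1) → ℝ) ∞ (Subtype.val : hyperquadric N l c → _) := by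
  intro p
  rw [contMDiffAt_iff]
  refine ⟨continuous_subtype_val.continuousAt, ?_⟩
  have := (contDiffOn_graphMap p).contDiffAt ((quadricChart p).open_target.mem_nhds
    ((quadricChart p).map_source (mem_chart_source (Fin N → ℝ) p)))
  refine ContDiffAt.contDiffWithinAt ?_
  refine this.congr_of_eventuallyEq ?_
  filter_upwards [(quadricChart p).open_target.mem_nhds
    ((quadricChart p).map_source (mem_chart_source (Fin N → ℝ) p))] with y hy
  exact quadricChart_symm p hy

instance : LocallyConnectedSpace (hyperquadric N l c) :=
  ChartedSpace.locallyConnectedSpace (Fin N → ℝ) _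

/-- The semi-Riemannian space form of dimension `N`, index `l` and curvature `c = ± 1`: the connected
component of the hyperquadric that contains the point `o`. It is an open submanifold. -/
def spaceForm (N l : ℕ) (c : ℤˣ) (o : hyperquadric N l c) :
    TopologicalSpace.Opens (hyperquadric N l c) :=
  ⟨connectedComponent o, isOpen_connectedComponent⟩

end charts


/-- A metric identifies covectors with vectors. -/
theorem Metric.exists_sharp [FiniteDimensional ℝ E] (g : Metric I M) (x : M) (φ : TangentSpace I x →L[ℝ] ℝ) :
    ∃ v : TangentSpace I x, ∀ w, g.val x v w = φ w := by
  have : FiniteDimensional ℝ (TangentSpace I x) := inferInstanceAs (FiniteDimensional ℝ E)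
  let B : TangentSpace I x →ₗ[ℝ] Module.Dual ℝ (TangentSpace I x) :=
    { toFun := fun v => (g.val x v).toLinearMap
      map_add' := by intros; ext; simp
      map_smul' := by intros; ext; simp }
  have hB : Function.Injective B := by
    rw [← LinearMap.ker_eq_bot, LinearMap.ker_eq_bot']
    intro v hv
    exact g.nondegenerate x v fun w => congr($hv w)
  have hs := (LinearMap.injective_iff_surjective_of_finrank_eq_finrank
    (Subspace.dual_finrank_eq (K := ℝ) (V := TangentSpace I x)).symm).1 hB
  obtain ⟨v, hv⟩ := hs φ.toLinearMap
  exact ⟨v, fun w => congr($hv w)⟩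

/-- The Levi-Civita connection of a metric. The conditions in `IsLeviCivita` determine it on all
differentiable vector fields. -/
def Metric.leviCivita [FiniteDimensional ℝ E] (g : Metric I M) :
    CovariantDerivative I E (TangentSpace I : M → Type _) :=
  (exists_leviCivita g).choose

theorem Metric.isLeviCivita_leviCivita [FiniteDimensional ℝ E] (g : Metric I M) :
    IsLeviCivita g g.leviCivita :=
  (exists_leviCivita g).choose_spec

/-- The vector that represents a covector through the metric. -/
def Metric.sharp [FiniteDimensional ℝ E] (g : Metric I M) (x : M) (φ : TangentSpace I x →L[ℝ] ℝ) :
    TangentSpace I x :=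
  (g.exists_sharp x φ).choose

theorem Metric.val_sharp [FiniteDimensional ℝ E] (g : Metric I M) (x : M)
    (φ : TangentSpace I x →L[ℝ] ℝ) (w : TangentSpace I x) : g.val x (g.sharp x φ) w = φ w :=
  (g.exists_sharp x φ).choose_spec w

/-- The gradient of a function: `g(grad h, w) = dh(w)`. -/
def Metric.gradient [FiniteDimensional ℝ E] (g : Metric I M) (h : M → ℝ) (x : M) :
    TangentSpace I x :=
  g.sharp x (mvfderiv I h x)

/-- The curvature operator `R(X, Y) Z = D_X D_Y Z - D_Y D_X Z - D_[X, Y] Z` of a connection. -/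
def curvature (D : CovariantDerivative I E (TangentSpace I : M → Type _))
    (X Y Z : Π x : M, TangentSpace I x) (x : M) : TangentSpace I x :=
  D (fun y ↦ D Z y (Y y)) x (X x) - D (fun y ↦ D Z y (X y)) x (Y x) -
    D Z x (VectorField.mlieBracket I X Y x)

/-- The curvature tensor `R(X, Y, Z, W) = g(R(X, Y) Z, W)` of a metric. -/
def Metric.curvatureTensor [FiniteDimensional ℝ E] (g : Metric I M)
    (X Y Z W : Π x : M, TangentSpace I x) (x : M) : ℝ :=
  g.val x (curvature g.leviCivita X Y Z x) (W x)

/-- A smooth vector field. -/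
def IsSmoothField (I : ModelWithCorners ℝ E H) {M : Type*} [TopologicalSpace M] [ChartedSpace H M]
    [IsManifold I ∞ M] (X : Π x : M, TangentSpace I x) : Prop :=
  ContMDiff I I.tangent ∞ (fun x ↦ (⟨x, X x⟩ : TangentBundle I M))

section immersions

variable {E₂ : Type*} [NormedAddCommGroup E₂] [NormedSpace ℝ E₂]
  {H₂ : Type*} [TopologicalSpace H₂] {I₂ : ModelWithCorners ℝ E₂ H₂}
  {M₂ : Type*} [TopologicalSpace M₂] [ChartedSpace H₂ M₂] [IsManifold I₂ ∞ M₂]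

/-- `f` is an isometric immersion of `(M, g)` into `(M₂, g₂)`. -/
structure IsIsometricImmersion (g : Metric I M) (g₂ : Metric I₂ M₂) (f : M → M₂) : Prop where
  contMDiff : ContMDiff I I₂ ∞ f
  injective (x : M) : Function.Injective (mfderiv I I₂ f x)
  isometric (x : M) (u v : TangentSpace I x) :
    g₂.val (f x) (mfderiv I I₂ f x u) (mfderiv I I₂ f x v) = g.val x u v

/-- The connection induced by `D` on vector fields along `f`, applied to the field `V` and the
tangent vector `u` at `x`. If `e_i` is the coordinate frame centred at `f x` and `V = ∑ V^i e_i`, this is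
`∑ dV^i(u) e_i + ∑ V^i D_{df(u)} e_i`; the first sum is the first term below, and
`FiberBundle.extend E₂ (V x)` is the field `∑ V^i(x) e_i` near `f x`. -/
def covDerivAlong (I : ModelWithCorners ℝ E H) [IsManifold I ∞ M]
    (D : CovariantDerivative I₂ E₂ (TangentSpace I₂ : M₂ → Type _)) (f : M → M₂)
    (V : Π x : M, TangentSpace I₂ (f x)) (x : M) (u : TangentSpace I x) : TangentSpace I₂ (f x) :=
  (trivializationAt E₂ (TangentSpace I₂ : M₂ → Type _) (f x)).symm (f x)
      (mvfderiv I (fun y ↦ (trivializationAt E₂ (TangentSpace I₂ : M₂ → Type _) (f x)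
        ⟨f y, V y⟩).2) x u) +
    D (FiberBundle.extend E₂ (V x)) (f x) (mfderiv I I₂ f x u)

/-- The tangential part of an ambient vector `w` at `f x`, as a tangent vector of `M`: the vector `v`
with `g(v, u) = g₂(w, df u)` for all `u`. -/
def tangentialPart [FiniteDimensional ℝ E] (g : Metric I M) (g₂ : Metric I₂ M₂) (f : M → M₂) (x : M)
    (w : TangentSpace I₂ (f x)) : TangentSpace I x :=
  g.sharp x (g₂.val (f x) w ∘L mfderiv I I₂ f x)

/-- The part of an ambient vector `w` at `f x` that is normal to the immersion `f`. -/
def normalPart [FiniteDimensional ℝ E] (g : Metric I M) (g₂ : Metric I₂ M₂) (f : M → M₂) (x : M)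
    (w : TangentSpace I₂ (f x)) : TangentSpace I₂ (f x) :=
  w - mfderiv I I₂ f x (tangentialPart g g₂ f x w)

/-- The second fundamental form `α(X, Y)` of an isometric immersion `f`: the normal part of the
ambient derivative of `df(Y)` in the direction of `X`. -/
def secondFundamentalForm [FiniteDimensional ℝ E] [FiniteDimensional ℝ E₂] (g : Metric I M)
    (g₂ : Metric I₂ M₂) (f : M → M₂) (X Y : Π x : M, TangentSpace I x) (x : M) :
    TangentSpace I₂ (f x) :=
  normalPart g g₂ f x
    (covDerivAlong I g₂.leviCivita f (fun y ↦ mfderiv I I₂ f y (Y y)) x (X x))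

end immersions

section pullbackForm

variable {V : Type*} [NormedAddCommGroup V] [NormedSpace ℝ V]

/-- The pull-back `B_x (dF_x u, dF_x v)` of a field of bilinear forms along `F : M → V`. -/
def pullbackForm (I : ModelWithCorners ℝ E H) (F : M → V) (B : M → V →L[ℝ] V →L[ℝ] ℝ) (x : M) :
    TangentSpace I x →L[ℝ] TangentSpace I x →L[ℝ] ℝ :=
  ContinuousLinearMap.precomp ℝ (mvfderiv I F x) ∘L B x ∘L mvfderiv I F x

theorem contMDiff_pullbackForm {F : M → V} (hF : ContMDiff I 𝓘(ℝ, V) ∞ F)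
    {B : M → V →L[ℝ] V →L[ℝ] ℝ} (hB : ContMDiff I 𝓘(ℝ, V →L[ℝ] V →L[ℝ] ℝ) ∞ B) :
    ContMDiff I (I.prod 𝓘(ℝ, E →L[ℝ] E →L[ℝ] ℝ)) ∞
      (fun x ↦ TotalSpace.mk' (E →L[ℝ] E →L[ℝ] ℝ) (E := fun x : M => TangentSpace I x →L[ℝ]
        TangentSpace I x →L[ℝ] ℝ) x (pullbackForm I F B x)) := by
  intro x
  rw [contMDiffAt_hom_bundle]
  refine ⟨contMDiffAt_id, ?_⟩
  have hA := (hF x).mfderiv_const (m := ∞) le_rfl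
  set A : M → E →L[ℝ] V := inTangentCoordinates I 𝓘(ℝ, V) id F (mfderiv I 𝓘(ℝ, V) F) x with hAdef
  have h := (hA.clm_precomp (F₃ := ℝ)).clm_comp ((hB x).clm_comp hA)
  refine h.congr_of_eventuallyEq ?_
  filter_upwards [(trivializationAt E (TangentSpace I : M → Type _) x).open_baseSet.mem_nhds
      (FiberBundle.mem_baseSet_trivializationAt' x)] with y hy
  have hAy (u : E) : A y u = mvfderiv I F y
      ((trivializationAt E (TangentSpace I : M → Type _) x).symm y u) := by
    rw [hAdef]
    simp only [inTangentCoordinates, ContinuousLinearMap.inCoordinates, id]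
    rw [TangentBundle.continuousLinearMapAt_model_space]
    change mvfderiv I F y (Trivialization.symmL ℝ (trivializationAt E (TangentSpace I) x) y u) = _
    rw [Trivialization.symmL_apply]
    exact hy
  refine ContinuousLinearMap.ext fun u => ContinuousLinearMap.ext fun v => ?_
  have := inCoordinates_apply_eq₂ (E₃ := Bundle.Trivial M ℝ) (F₃ := ℝ)
    (ϕ := pullbackForm I F B y) (v := u) (w := v) hy hy (by trivial)
  refine this.trans ?_
  change _ = B y (A y u) (A y v)
  rw [hAy, hAy]
  simp
  rfl

theorem contMDiff_pullbackForm_add {V' : Type*} [NormedAddCommGroup V'] [NormedSpace ℝ V']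
    {F : M → V} (hF : ContMDiff I 𝓘(ℝ, V) ∞ F)
    {B : M → V →L[ℝ] V →L[ℝ] ℝ} (hB : ContMDiff I 𝓘(ℝ, V →L[ℝ] V →L[ℝ] ℝ) ∞ B)
    {F' : M → V'} (hF' : ContMDiff I 𝓘(ℝ, V') ∞ F')
    {B' : M → V' →L[ℝ] V' →L[ℝ] ℝ} (hB' : ContMDiff I 𝓘(ℝ, V' →L[ℝ] V' →L[ℝ] ℝ) ∞ B') :
    ContMDiff I (I.prod 𝓘(ℝ, E →L[ℝ] E →L[ℝ] ℝ)) ∞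
      (fun x ↦ TotalSpace.mk' (E →L[ℝ] E →L[ℝ] ℝ) (E := fun x : M => TangentSpace I x →L[ℝ]
        TangentSpace I x →L[ℝ] ℝ) x (pullbackForm I F B x + pullbackForm I F' B' x)) :=
  ContMDiff.add_section (contMDiff_pullbackForm hF hB) (contMDiff_pullbackForm hF' hB')

end pullbackForm

section warped

variable {N l : ℕ} {c : ℤˣ}

/-- The manifold `J × M` of a warped product, `J` an open set of reals and `M` the space form. -/
abbrev WarpedProduct (J : TopologicalSpace.Opens ℝ) (o : hyperquadric N l c) : Type :=
  J × spaceForm N l c o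

/-- The model with corners of `J × M`. -/
abbrev warpedModel (N : ℕ) : ModelWithCorners ℝ (ℝ × (Fin N → ℝ)) (ModelProd ℝ (Fin N → ℝ)) :=
  𝓘(ℝ, ℝ).prod 𝓘(ℝ, Fin N → ℝ)

variable {J : TopologicalSpace.Opens ℝ} {o : hyperquadric N l c}

/-- The projection `(t, x) ↦ t` of the warped product to the line. -/
def time (p : WarpedProduct J o) : ℝ := p.1
/-- The projection `(t, x) ↦ x`, with values in `ℝ^(N+1)`. -/
def space (p : WarpedProduct J o) : Fin (N + 1) → ℝ := p.2.1.1

theorem contMDiff_time : ContMDiff (warpedModel N) 𝓘(ℝ, ℝ) ∞ (time (J := J) (o := o)) :=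
  contMDiff_subtype_val.comp contMDiff_fst

theorem contMDiff_space :
    ContMDiff (warpedModel N) 𝓘(ℝ, Fin (N + 1) → ℝ) ∞ (space (J := J) (o := o)) :=
  contMDiff_coe_hyperquadric.comp (contMDiff_subtype_val.comp contMDiff_snd)

theorem mvfderiv_time (p : WarpedProduct J o) (u : TangentSpace (warpedModel N) p) :
    mvfderiv (warpedModel N) time p u = u.1 := by
  have h1 := (mdifferentiableAt_extChartAt (I := warpedModel N) (mem_chart_source _ p))
  have h2 := ((ContinuousLinearMap.fst ℝ ℝ (Fin N → ℝ)).hasMFDerivAt (x := extChartAt (warpedModel N) p p)).comp p h1.hasMFDerivAt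
  rw [mfderiv_extChartAt_self] at h2
  have h3 := h2.mfderiv
  exact congr($h3 u)

theorem mvfderiv_space (p : WarpedProduct J o) (u : TangentSpace (warpedModel N) p) (j : Fin N) :
    mvfderiv (warpedModel N) space p u ((pivot p.2.1).succAbove j) = u.2 j := by
  have h1 := (mdifferentiableAt_extChartAt (I := warpedModel N) (mem_chart_source _ p))
  have h2 := ((ContinuousLinearMap.proj (R := ℝ) (φ := fun _ : Fin N => ℝ) j ∘L
    ContinuousLinearMap.snd ℝ ℝ (Fin N → ℝ)).hasMFDerivAt
      (x := extChartAt (warpedModel N) p p)).comp p h1.hasMFDerivAt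
  rw [mfderiv_extChartAt_self] at h2
  have h4 := ((contMDiff_space (J := J) (o := o)) p).mdifferentiableAt (by simp)
  have h5 := ((ContinuousLinearMap.proj (R := ℝ) (φ := fun _ : Fin (N + 1) => ℝ)
    ((pivot p.2.1).succAbove j)).hasMFDerivAt (x := space p)).comp p h4.hasMFDerivAt
  exact congr($(h5.mfderiv.symm.trans h2.mfderiv) u)

theorem pseudoForm_comm (N μ : ℕ) (x y) : pseudoForm N μ x y = pseudoForm N μ y x := by
  simp only [pseudoForm_apply, mul_comm]

theorem pseudoForm_space (p : WarpedProduct J o) (u : TangentSpace (warpedModel N) p) :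
    pseudoForm N (ambientIndex l c) (mvfderiv (warpedModel N) space p u) (space p) = 0 := by
  have h4 := ((contMDiff_space (J := J) (o := o)) p).mdifferentiableAt (by simp)
  have h := mvfderiv_bilin (mdifferentiableAt_const (c := pseudoForm N (ambientIndex l c))) h4 h4 u
  have h1 : (fun q : WarpedProduct J o => pseudoForm N (ambientIndex l c) (space q) (space q)) =
      fun _ => ((c : ℤ) : ℝ) := funext fun q => q.2.1.2
  have e0 {F : Type} [NormedAddCommGroup F] [NormedSpace ℝ F] (k : F) :
      mvfderiv (warpedModel N) (fun _ : WarpedProduct J o => k) p u = 0 := by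
    rw [mvfderiv_const]; rfl
  rw [h1, e0, e0, pseudoForm_comm _ _ (space p)] at h
  simp only [_root_.zero_apply, zero_add] at h
  linarith

theorem pseudoForm_nondegenerate (N μ : ℕ) (x : Fin (N + 1) → ℝ) (h : ∀ y, pseudoForm N μ x y = 0) :
    x = 0 := by
  funext i
  have := h (Pi.single i 1)
  rw [pseudoForm_apply, Finset.sum_eq_single i (by intro j _ hj; simp [hj]) (by simp)] at this
  have h2 := signature_mul_self N μ i
  simp only [Pi.single_eq_same, mul_one] at this
  simpa using (mul_eq_zero.1 this).resolve_left fun h0 => by rw [h0] at h2; norm_num at h2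

theorem exists_tangent (p : WarpedProduct J o) (s : ℝ) (z : Fin (N + 1) → ℝ)
    (hz : pseudoForm N (ambientIndex l c) z (space p) = 0) :
    ∃ u : TangentSpace (warpedModel N) p, mvfderiv (warpedModel N) time p u = s ∧
      mvfderiv (warpedModel N) space p u = z := by
  let u : TangentSpace (warpedModel N) p := ((s, fun j => z ((pivot p.2.1).succAbove j)) : ℝ × (Fin N → ℝ))
  refine ⟨u, mvfderiv_time p u, ?_⟩
  have h1 := mvfderiv_space p u
  have h2 := pseudoForm_space p u
  generalize mvfderiv (warpedModel N) space p u = x at h1 h2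
  have h3 : ∀ j, x ((pivot p.2.1).succAbove j) = z ((pivot p.2.1).succAbove j) := h1
  rw [pseudoForm_apply, Fin.sum_univ_succAbove _ (pivot p.2.1)] at h2 hz
  simp only [h3] at h2
  have h4 := signature_mul_self N (ambientIndex l c) (pivot p.2.1)
  have h5 : space p (pivot p.2.1) ≠ 0 := pivot_ne p.2.1
  funext k
  refine Fin.succAboveCases (pivot p.2.1) ?_ h3 k
  have h6 : signature N (ambientIndex l c) (pivot p.2.1) ≠ 0 := fun h0 => by
    rw [h0] at h4; norm_num at h4
  exact mul_right_cancel₀ h5 (mul_left_cancel₀ h6 (by linarith))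

/-- The warped product metric `ε dt² + a(t)² g` on `J × M`, where `g` is the metric that the flat metric
`g₀` of `ℝ^(N+1)` induces on the space form `M`. -/
def warpedMetric (ε : ℤˣ) (J : TopologicalSpace.Opens ℝ) (a : ℝ → ℝ) (ha : ContDiffOn ℝ ∞ a J)
    (hpos : ∀ t ∈ J, 0 < a t) (o : hyperquadric N l c) :
    Metric (warpedModel N) (WarpedProduct J o) where
  val p := pullbackForm (warpedModel N) time (fun _ => ((ε : ℤ) : ℝ) • ContinuousLinearMap.mul ℝ ℝ) p +
    pullbackForm (warpedModel N) space
      (fun q => a (time q) ^ 2 • pseudoForm N (ambientIndex l c)) p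
  symm p u v := by
    change ((ε : ℤ) : ℝ) • (_ * _) + a (time p) ^ 2 • pseudoForm N _ _ _ = ((ε : ℤ) : ℝ) • (_ * _) + a (time p) ^ 2 • pseudoForm N _ _ _
    rw [mul_comm, pseudoForm_comm]
  nondegenerate p u hu := by
    have hu' (v : TangentSpace (warpedModel N) p) :
        ((ε : ℤ) : ℝ) * (mvfderiv (warpedModel N) time p u * mvfderiv (warpedModel N) time p v) +
          a (time p) ^ 2 * pseudoForm N (ambientIndex l c) (mvfderiv (warpedModel N) space p u)
            (mvfderiv (warpedModel N) space p v) = 0 := hu v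
    have hap : a (time p) ^ 2 ≠ 0 := (pow_pos (hpos _ p.1.2) 2).ne'
    have h1 : mvfderiv (warpedModel N) time p u = 0 := by
      obtain ⟨v, hv1, hv2⟩ := exists_tangent p 1 0 (by simp)
      have := hu' v
      rw [hv1, hv2] at this
      simpa [unit_ne_zero ε] using this
    have h2 : mvfderiv (warpedModel N) space p u = 0 := by
      refine pseudoForm_nondegenerate N (ambientIndex l c) _ fun y => ?_
      have hp : pseudoForm N (ambientIndex l c) (space p) (space p) = ((c : ℤ) : ℝ) := p.2.1.2
      obtain ⟨v, hv1, hv2⟩ := exists_tangent p 0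
        (y - (pseudoForm N (ambientIndex l c) y (space p) / ((c : ℤ) : ℝ)) • space p) (by
          rw [map_sub, map_smul, sub_apply, smul_apply, hp, smul_eq_mul,
            div_mul_cancel₀ _ (unit_ne_zero c), sub_self])
      have := hu' v
      rw [hv1, hv2, map_sub, map_smul, pseudoForm_space] at this
      simpa [hap] using this
    have h3 := mvfderiv_time p u
    have h4 := mvfderiv_space p u
    rw [h1] at h3
    rw [h2] at h4
    exact Prod.ext h3.symm (funext fun j => (h4 j).symm)
  contMDiff := by
    have : ContMDiff (warpedModel N) 𝓘(ℝ, ℝ) ∞ fun q : WarpedProduct J o => a (time q) := by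
      intro q
      have h := (ha.contDiffAt (J.isOpen.mem_nhds q.1.2)).contMDiffAt
      exact h.comp q (contMDiff_time q)
    exact contMDiff_pullbackForm_add contMDiff_time contMDiff_const contMDiff_space
      ((this.pow 2).smul contMDiff_const)

end warped

end SemiRiemannian

end

noncomputable section

namespace SemiRiemannian

/-! ### Second derivatives of functions and fields in coordinate frames -/

section frames

variable {E : Type*} [NormedAddCommGroup E] [NormedSpace ℝ E]
  {H : Type*} [TopologicalSpace H] {I : ModelWithCorners ℝ E H}
  {M : Type*} [TopologicalSpace M] [ChartedSpace H M]
  {V : Type*} [NormedAddCommGroup V] [NormedSpace ℝ V]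

/-! The space form lies in a flat space V as the hyperquadric β(p, p) = c. A map to the warped
product is therefore a pair (t, F) with values in ℝ × V, and a tangent vector along it is a pair (s,
z) with β(z, F) = 0 and square ε s² + a(t)² β(z, z). In these global components the Levi-Civita
connection of the warped product is explicit: differentiate s and z as functions, add the warping
terms in a', and add the multiple of F that keeps z tangent to the quadric (`WarpedMap.baseDeriv`,
`WarpedMap.fibreDeriv`). The formulas make sense along any map to the warped product, in particular
along f. Write D for this connection and ∇ for that of M.

Ambient curvature: second derivatives of functions commute up to the bracket
(`mvfderiv_mlieBracket`), so the commutator of D on fields along the map loses its second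
derivatives. What remains is algebra in first derivatives and gives the terms in (a')²/a², c/a² and
a''/a (`WarpedMap.form_curvature`).

Gauss: by Koszul's argument ∇ is the tangential part of D (`WarpedMap.Induces.val_leviCivita`).
Differentiating ⟨∇_Y Z, W⟩ = ⟨D_Y Z, W⟩ along X, with the metric rule on both sides, gives ⟨∇_X ∇_Y
Z, W⟩ = ⟨D_X D_Y Z, W⟩ + ⟨D_Y Z, D_X W⟩ - ⟨∇_Y Z, ∇_X W⟩. The last difference is ⟨α(Y, Z), α(X, W)⟩,
and skew-symmetrizing in X and Y yields the equation (`WarpedMap.Induces.curvatureTensor_eq`).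

There remains the link with the second fundamental form, which is defined through an abstract
connection and a trivialization. The pair (dt, dF) maps the ambient tangent spaces onto all
admissible pairs (s, z), so the ambient connection has exactly the components of D
(`WarpedMap.Induces.mvfderiv_covDerivAlong`). The scalar product of normal parts is then the
difference above (`WarpedMap.Induces.val_secondFundamentalForm`). -/

theorem mvfderiv_clm_apply {V' : Type*} [NormedAddCommGroup V'] [NormedSpace ℝ V'] {x : M}
    {G : M → V →L[ℝ] V'} {b : M → V} (hG : MDifferentiableAt I 𝓘(ℝ, V →L[ℝ] V') G x)
    (hb : MDifferentiableAt I 𝓘(ℝ, V) b x) (v : TangentSpace I x) :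
    mvfderiv I (fun y => G y (b y)) x v = mvfderiv I G x v (b x) + G x (mvfderiv I b x v) := by
  rw [(hG.clm_apply hb).mvfderiv, hG.mvfderiv, hb.mvfderiv]
  have hG' := hG.differentiableWithinAt_writtenInExtChartAt.hasFDerivWithinAt
  have hb' := hb.differentiableWithinAt_writtenInExtChartAt.hasFDerivWithinAt
  have h2 := (hG'.clm_apply hb').fderivWithin (I.uniqueDiffOn _ (Set.mem_range_self _))
  refine (congrArg (fun T : E →L[ℝ] V' => T v) h2).trans ?_
  have e1 : writtenInExtChartAt I 𝓘(ℝ, V →L[ℝ] V') x G (extChartAt I x x) = G x := by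
    simp [writtenInExtChartAt]; rfl
  have e2 : writtenInExtChartAt I 𝓘(ℝ, V) x b (extChartAt I x x) = b x := by
    simp [writtenInExtChartAt]; rfl
  rw [e1, e2]
  generalize fderivWithin ℝ (writtenInExtChartAt I 𝓘(ℝ, V →L[ℝ] V') x G) (Set.range ↑I)
    (extChartAt I x x) = P
  generalize fderivWithin ℝ (writtenInExtChartAt I 𝓘(ℝ, V) x b) (Set.range ↑I)
    (extChartAt I x x) = Q
  change G x (Q v) + P v (b x) = P v (b x) + G x (Q v)
  abel

theorem mvfderiv_comp_map {E₂ : Type*} [NormedAddCommGroup E₂] [NormedSpace ℝ E₂]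
    {H₂ : Type*} [TopologicalSpace H₂] {I₂ : ModelWithCorners ℝ E₂ H₂}
    {M₂ : Type*} [TopologicalSpace M₂] [ChartedSpace H₂ M₂] {f : M → M₂} {F : M₂ → V} {x : M}
    (hF : MDifferentiableAt I₂ 𝓘(ℝ, V) F (f x)) (hf : MDifferentiableAt I I₂ f x)
    (v : TangentSpace I x) :
    mvfderiv I (fun y => F (f y)) x v = mvfderiv I₂ F (f x) (mfderiv I I₂ f x v) :=
  mfderiv_comp_apply x hF hf v

variable [IsManifold I ∞ M]

/-- The tangent space at `x` is the model space read in the preferred chart at `x`, so the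
coordinate frame centred at `x` is the identity over `x` itself. With this, coordinates disappear
from every formula evaluated at the centre. -/
theorem trivializationAt_snd_self (x : M) (u : TangentSpace I x) :
    (trivializationAt E (TangentSpace I) x ⟨x, u⟩).2 = u := by
  have := coord_self x (FiberBundle.extend E u)
  rwa [coord, FiberBundle.extend_apply_self] at this

theorem trivializationAt_symm_self (x : M) (u : E) :
    (trivializationAt E (TangentSpace I : M → Type _) x).symm x u = u := by
  have h := (trivializationAt E (TangentSpace I : M → Type _) x).symm_apply_apply_mk
    (FiberBundle.mem_baseSet_trivializationAt' x) (u : TangentSpace I x)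
  exact (congrArg _ (trivializationAt_snd_self (I := I) x u)).symm.trans h

theorem extend_eq_symm {x : M} (u : TangentSpace I x) (q : M) :
    FiberBundle.extend E u q = (trivializationAt E (TangentSpace I : M → Type _) x).symm q u :=
  congrArg _ (trivializationAt_snd_self (I := I) x u)

/-- The differential of `F` at `q`, in the coordinate frame centred at `x`. -/
def frameDeriv (I : ModelWithCorners ℝ E H) [IsManifold I ∞ M] (F : M → V) (x q : M) : E →L[ℝ] V :=
  mvfderiv I F q ∘L (trivializationAt E (TangentSpace I : M → Type _) x).symmL ℝ q

theorem mem_baseSet_eventually (x : M) :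
    ∀ᶠ q in 𝓝 x, q ∈ (trivializationAt E (TangentSpace I : M → Type _) x).baseSet :=
  (trivializationAt E (TangentSpace I : M → Type _) x).open_baseSet.mem_nhds
    (FiberBundle.mem_baseSet_trivializationAt' x)

theorem frameDeriv_apply (F : M → V) {x q : M}
    (hq : q ∈ (trivializationAt E (TangentSpace I : M → Type _) x).baseSet) (u : E) :
    frameDeriv I F x q u =
      mvfderiv I F q ((trivializationAt E (TangentSpace I : M → Type _) x).symm q u) := by
  rw [frameDeriv, ContinuousLinearMap.comp_apply, Trivialization.symmL_apply]
  exact hq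

theorem mvfderiv_eq_frameDeriv (F : M → V) {x q : M}
    (hq : q ∈ (trivializationAt E (TangentSpace I : M → Type _) x).baseSet)
    (u : TangentSpace I q) :
    mvfderiv I F q u = frameDeriv I F x q (trivializationAt E (TangentSpace I) x ⟨q, u⟩).2 := by
  rw [frameDeriv_apply F hq, Trivialization.symm_apply_apply_mk _ hq]

theorem frameDeriv_self (F : M → V) (x : M) (u : TangentSpace I x) :
    frameDeriv I F x x u = mvfderiv I F x u := by
  rw [mvfderiv_eq_frameDeriv F (FiberBundle.mem_baseSet_trivializationAt' x) u,
    trivializationAt_snd_self]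

/-- Near `x` this is the coordinate expression of the differential, which is smooth together with
`F`. -/
theorem contMDiffAt_frameDeriv {F : M → V} (hF : ContMDiff I 𝓘(ℝ, V) ∞ F) (x : M) :
    ContMDiffAt I 𝓘(ℝ, E →L[ℝ] V) ∞ (frameDeriv I F x) x := by
  have hA := (hF x).mfderiv_const (m := ∞) le_rfl
  refine hA.congr_of_eventuallyEq ?_
  filter_upwards [mem_baseSet_eventually (I := I) x] with y hy
  ext u
  rw [frameDeriv_apply F hy]
  simp only [inTangentCoordinates, ContinuousLinearMap.inCoordinates, id]
  rw [TangentBundle.continuousLinearMapAt_model_space]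
  change _ = mvfderiv I F y (Trivialization.symmL ℝ (trivializationAt E (TangentSpace I) x) y u)
  rw [Trivialization.symmL_apply]
  exact hy

/-- In the chart at `x` the derivative of `frameDeriv` is the second derivative of the coordinate
expression of `F`, and that is symmetric. -/
theorem mvfderiv_frameDeriv_symm [I.Boundaryless] {F : M → V} (hF : ContMDiff I 𝓘(ℝ, V) ∞ F)
    (x : M) (u v : E) :
    mvfderiv I (frameDeriv I F x) x u v = mvfderiv I (frameDeriv I F x) x v u := by
  have hd := (contMDiffAt_frameDeriv hF x).mdifferentiableAt (by simp)
  rw [hd.mvfderiv, I.range_eq_univ, fderivWithin_univ]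
  have hF2 : ContDiffAt ℝ ∞ (F ∘ (extChartAt I x).symm) (extChartAt I x x) := by
    have := (contMDiffAt_iff.1 (hF x)).2
    rw [I.range_eq_univ, contDiffWithinAt_univ] at this
    exact this
  -- The coordinate frame is the differential of the inverse chart, so the chain rule turns
  -- `frameDeriv` into an ordinary derivative.
  have key : writtenInExtChartAt I 𝓘(ℝ, E →L[ℝ] V) x (frameDeriv I F x) =ᶠ[𝓝 (extChartAt I x x)]
      fderiv ℝ (F ∘ (extChartAt I x).symm) := by
    filter_upwards [extChartAt_target_mem_nhds (I := I) x] with y hy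
    have hs : (extChartAt I x).symm y ∈ (chartAt H x).source := by
      rw [← extChartAt_source I]; exact (extChartAt I x).map_target hy
    change frameDeriv I F x ((extChartAt I x).symm y) = _
    rw [frameDeriv, TangentBundle.symmL_trivializationAt hs]
    rw [(extChartAt I x).right_inv hy, I.range_eq_univ, mfderivWithin_univ]
    have h1 : MDifferentiableAt 𝓘(ℝ, E) I (extChartAt I x).symm y := by
      have := mdifferentiableWithinAt_extChartAt_symm (I := I) hy
      rwa [I.range_eq_univ, mdifferentiableWithinAt_univ] at this
    rw [← mfderiv_eq_fderiv]
    exact (mfderiv_comp y ((hF _).mdifferentiableAt (by simp)) h1).symm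
  rw [key.fderiv_eq]
  exact hF2.isSymmSndFDerivAt (by simpa using! (mod_cast le_top : ((2 : ℕ∞) : WithTop ℕ∞) ≤ ∞)) u v

theorem mdifferentiableAt_mvfderiv_field {F : M → V} (hF : ContMDiff I 𝓘(ℝ, V) ∞ F) {x : M}
    {Y : Π y : M, TangentSpace I y} (hY : MDiffAt (T% Y) x) :
    MDifferentiableAt I 𝓘(ℝ, V) (fun y => mvfderiv I F y (Y y)) x := by
  refine (((contMDiffAt_frameDeriv hF x).mdifferentiableAt (by simp)).clm_apply
    (coord_mdiff hY)).congr_of_eventuallyEq ?_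
  filter_upwards [mem_baseSet_eventually (I := I) x] with q hq
  exact mvfderiv_eq_frameDeriv F hq _

theorem contMDiff_mvfderiv_field {F : M → V} (hF : ContMDiff I 𝓘(ℝ, V) ∞ F)
    {Y : Π y : M, TangentSpace I y} (hY : IsSmoothField I Y) :
    ContMDiff I 𝓘(ℝ, V) ∞ (fun y => mvfderiv I F y (Y y)) := by
  intro x
  refine ((contMDiffAt_frameDeriv hF x).clm_apply
    (contMDiffAt_totalSpace.1 (hY x)).2).congr_of_eventuallyEq ?_
  filter_upwards [mem_baseSet_eventually (I := I) x] with q hq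
  exact mvfderiv_eq_frameDeriv F hq _

theorem IsSmoothField.mdifferentiableAt {Y : Π y : M, TangentSpace I y} (hY : IsSmoothField I Y)
    (x : M) : MDiffAt (T% Y) x :=
  (hY x).mdifferentiableAt (by simp)

/-- Leibniz rule in the frame centred at `x`: a coordinate Hessian of `F`, symmetric in `v` and `Y
x`, plus `dF` applied to the derivative of the coefficients of `Y`. Only the second term survives
skew-symmetrization. -/
theorem mvfderiv_mvfderiv_field {F : M → V} (hF : ContMDiff I 𝓘(ℝ, V) ∞ F) {x : M}
    {Y : Π y : M, TangentSpace I y} (hY : MDiffAt (T% Y) x) (v : TangentSpace I x) :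
    mvfderiv I (fun y => mvfderiv I F y (Y y)) x v =
      mvfderiv I (frameDeriv I F x) x v (Y x) + mvfderiv I F x (mvfderiv I (coord x Y) x v) := by
  have h : (fun y => mvfderiv I F y (Y y)) =ᶠ[𝓝 x] fun y => frameDeriv I F x y (coord x Y y) := by
    filter_upwards [mem_baseSet_eventually (I := I) x] with q hq
    exact mvfderiv_eq_frameDeriv F hq _
  rw [mvfderiv_congr h, mvfderiv_clm_apply
    ((contMDiffAt_frameDeriv hF x).mdifferentiableAt (by simp)) (coord_mdiff hY), coord_self]
  congr 1
  exact frameDeriv_self F x _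

/-- The second derivatives of a function commute up to the bracket of the vector fields. -/
theorem mvfderiv_mlieBracket [I.Boundaryless] {F : M → V} (hF : ContMDiff I 𝓘(ℝ, V) ∞ F) {x : M}
    {X Y : Π y : M, TangentSpace I y} (hX : MDiffAt (T% X) x) (hY : MDiffAt (T% Y) x) :
    mvfderiv I F x (VectorField.mlieBracket I X Y x) =
      mvfderiv I (fun y => mvfderiv I F y (Y y)) x (X x) -
        mvfderiv I (fun y => mvfderiv I F y (X y)) x (Y x) := by
  rw [mvfderiv_mvfderiv_field hF hY, mvfderiv_mvfderiv_field hF hX, ← coord_bracket x X Y hX hY]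
  have h := mvfderiv_frameDeriv_symm hF x (X x) (Y x)
  refine (map_sub (mvfderiv I F x) _ _).trans ?_
  rw [h]
  abel

section along

variable {E₂ : Type*} [NormedAddCommGroup E₂] [NormedSpace ℝ E₂]
  {H₂ : Type*} [TopologicalSpace H₂] {I₂ : ModelWithCorners ℝ E₂ H₂}
  {M₂ : Type*} [TopologicalSpace M₂] [ChartedSpace H₂ M₂] [IsManifold I₂ ∞ M₂]

omit [IsManifold I ∞ M] in
/-- The derivative of `dF(U)` for a vector field `U` along `f`. The right-hand side is the
derivative of `dF` on the field `FiberBundle.extend E₂ (U x)`, with constant coefficients, plus the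
contribution of the derivatives of the coefficients. -/
theorem mvfderiv_mvfderiv_along {f : M → M₂} {F : M₂ → V} (hF : ContMDiff I₂ 𝓘(ℝ, V) ∞ F) {x : M}
    {U : Π y : M, TangentSpace I₂ (f y)}
    (hU : MDifferentiableAt I I₂.tangent (fun y => (⟨f y, U y⟩ : TangentBundle I₂ M₂)) x)
    (v : TangentSpace I x) :
    mvfderiv I (fun y => mvfderiv I₂ F (f y) (U y)) x v =
      mvfderiv I₂ F (f x) ((trivializationAt E₂ (TangentSpace I₂ : M₂ → Type _) (f x)).symm (f x)
        (mvfderiv I (fun y ↦ (trivializationAt E₂ (TangentSpace I₂ : M₂ → Type _) (f x)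
        ⟨f y, U y⟩).2) x v)) +
      mvfderiv I₂ (fun q => mvfderiv I₂ F q (FiberBundle.extend E₂ (U x) q)) (f x)
        (mfderiv I I₂ f x v) := by
  obtain ⟨hf, hU2⟩ := (mdifferentiableAt_totalSpace ..).1 hU
  have hf' : MDifferentiableAt I I₂ f x := hf
  have hd := (contMDiffAt_frameDeriv hF (f x)).mdifferentiableAt (by simp)
  have h : (fun y => mvfderiv I₂ F (f y) (U y)) =ᶠ[𝓝 x] fun y => frameDeriv I₂ F (f x) (f y)
      (trivializationAt E₂ (TangentSpace I₂ : M₂ → Type _) (f x) ⟨f y, U y⟩).2 := by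
    filter_upwards [hf'.continuousAt.eventually (mem_baseSet_eventually (I := I₂) (f x))] with q hq
    exact mvfderiv_eq_frameDeriv F hq _
  -- The vector `U x` is read in the model space, so that it can serve as a constant coefficient at
  -- points other than `f x`.
  obtain ⟨e, he⟩ : ∃ e : E₂, U x = e := ⟨_, rfl⟩
  have h' : (fun q => mvfderiv I₂ F q (FiberBundle.extend E₂ (U x) q)) =ᶠ[𝓝 (f x)]
      fun q => frameDeriv I₂ F (f x) q e := by
    filter_upwards [mem_baseSet_eventually (I := I₂) (f x)] with q hq
    rw [frameDeriv_apply F hq, extend_eq_symm, he]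
  have e0 : mvfderiv I₂ (fun _ : M₂ => e) (f x) (mfderiv I I₂ f x v) = 0 := by
    rw [mvfderiv_const]; rfl
  have := h.mfderiv_eq (I := I) (I' := 𝓘(ℝ, V))
  have h3 := mvfderiv_clm_apply (hd.comp x hf') hU2 v
  have h4 := mvfderiv_clm_apply hd (mdifferentiableAt_const (c := e))
    (mfderiv I I₂ f x v)
  rw [mvfderiv_congr h', h4, e0, map_zero, add_zero]
  have h5 : mvfderiv I (fun y => mvfderiv I₂ F (f y) (U y)) x v =
     mvfderiv I (fun y => frameDeriv I₂ F (f x) (f y)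
      (trivializationAt E₂ (TangentSpace I₂ : M₂ → Type _) (f x) ⟨f y, U y⟩).2) x v :=
    congr($this v)
  rw [h5]
  refine h3.trans ?_
  rw [add_comm]
  congr 1
  · rw [trivializationAt_symm_self]
    exact frameDeriv_self F (f x) _
  · have := mvfderiv_comp_map hd hf' v
    rw [trivializationAt_snd_self, he]
    exact congr($this e)

end along

omit [IsManifold I ∞ M] in
-- Near `x` one has `u = A⁻¹ (A u)`, and inversion is differentiable at an invertible operator.
theorem mdifferentiableAt_of_clm_apply {F G : Type*} [NormedAddCommGroup F] [NormedSpace ℝ F]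
    [CompleteSpace F] [NormedAddCommGroup G] [NormedSpace ℝ G] {A : M → F →L[ℝ] G} {u : M → F}
    {x : M} (hA : MDifferentiableAt I 𝓘(ℝ, F →L[ℝ] G) A x) (e : F ≃L[ℝ] G)
    (he : (e : F →L[ℝ] G) = A x) (h : MDifferentiableAt I 𝓘(ℝ, G) (fun y => A y (u y)) x) :
    MDifferentiableAt I 𝓘(ℝ, F) u x := by
  have h1 : DifferentiableAt ℝ
      (ContinuousLinearMap.inverse : (F →L[ℝ] G) → G →L[ℝ] F) (A x) := by
    rw [← he]
    exact (contDiffAt_map_inverse (n := 1) e).differentiableAt (by simp)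
  refine ((h1.mdifferentiableAt.comp x hA).clm_apply h).congr_of_eventuallyEq ?_
  -- Invertibility is an open condition. Where it fails, `ContinuousLinearMap.inverse` has the
  -- default value zero, so the identity is claimed only near `x`.
  filter_upwards [hA.continuousAt.eventually (he ▸ e.nhds)] with y hy
  obtain ⟨e', he'⟩ := hy
  simp only [Function.comp_apply]
  rw [← he', ContinuousLinearMap.inverse_equiv]
  exact (e'.symm_apply_apply _).symm

/-- A vector field is differentiable if its scalar products with the coordinate frame are. -/
theorem Metric.mdifferentiableAt_of_val [FiniteDimensional ℝ E] (g : Metric I M) {x : M}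
    {σ : Π y : M, TangentSpace I y}
    (h : ∀ w : TangentSpace I x,
      MDifferentiableAt I 𝓘(ℝ, ℝ) (fun y => g.val y (σ y) (FiberBundle.extend E w y)) x) :
    MDiffAt (T% σ) x := by
  let G (y : M) : E →L[ℝ] E →L[ℝ] ℝ :=
    ContinuousLinearMap.inCoordinates E (TangentSpace I : M → Type _) (E →L[ℝ] ℝ)
      (fun x : M => TangentSpace I x →L[ℝ] ℝ) x y x y (g.val y)
  have hG : MDifferentiableAt I 𝓘(ℝ, E →L[ℝ] E →L[ℝ] ℝ) G x :=
    ((mdifferentiableAt_hom_bundle _).1 ((g.contMDiff x).mdifferentiableAt (by simp))).2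
  have hval (y : M) (hy : y ∈ (trivializationAt E (TangentSpace I : M → Type _) x).baseSet)
      (u v : E) : G y u v = g.val y ((trivializationAt E (TangentSpace I : M → Type _) x).symm y u)
        ((trivializationAt E (TangentSpace I : M → Type _) x).symm y v) := by
    have := inCoordinates_apply_eq₂ (E₃ := Bundle.Trivial M ℝ) (F₃ := ℝ) (ϕ := g.val y) (v := u)
      (w := v) hy hy (by trivial)
    simpa using this
  have hinj : Function.Injective (G x : E →ₗ[ℝ] E →L[ℝ] ℝ) := by
    rw [← LinearMap.ker_eq_bot, LinearMap.ker_eq_bot']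
    refine fun u hu => g.nondegenerate x u fun (w : E) => ?_
    have h1 := hval x (FiberBundle.mem_baseSet_trivializationAt' x) u w
    rw [trivializationAt_symm_self, trivializationAt_symm_self] at h1
    exact h1.symm.trans congr($hu w)
  have hdim : Module.finrank ℝ E = Module.finrank ℝ (E →L[ℝ] ℝ) := by
    rw [← Subspace.dual_finrank_eq (K := ℝ) (V := E)]
    exact (LinearMap.toContinuousLinearMap (𝕜 := ℝ) (E := E) (F' := ℝ)).finrank_eq
  have : CompleteSpace E := FiniteDimensional.complete ℝ E
  let e : E ≃L[ℝ] (E →L[ℝ] ℝ) :=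
    (LinearMap.linearEquivOfInjective (G x : E →ₗ[ℝ] E →L[ℝ] ℝ) hinj hdim).toContinuousLinearEquiv
  have he : (e : E →L[ℝ] E →L[ℝ] ℝ) = G x := by ext; rfl
  have hφ (w : E) : MDifferentiableAt I 𝓘(ℝ, ℝ) (fun y => G y (coord x σ y) w) x := by
    refine (h w).congr_of_eventuallyEq ?_
    filter_upwards [mem_baseSet_eventually (I := I) x] with y hy
    rw [hval y hy, coord, Trivialization.symm_apply_apply_mk _ hy]
    exact congrArg _ (extend_eq_symm (I := I) (x := x) w y).symm
  let b := Module.finBasis ℝ E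
  -- `T` rebuilds a covector from its values on a basis, so a covector-valued map is differentiable
  -- as soon as its finitely many components are.
  let T : (Fin (Module.finrank ℝ E) → ℝ) →L[ℝ] E →L[ℝ] ℝ := LinearMap.toContinuousLinearMap
    ((LinearMap.toContinuousLinearMap (𝕜 := ℝ) (E := E) (F' := ℝ)).toLinearMap ∘ₗ
      (b.constr ℝ).toLinearMap)
  have hT (ψ : E →L[ℝ] ℝ) : T (fun i => ψ (b i)) = ψ := by
    apply ContinuousLinearMap.coe_injective
    exact b.ext fun i => b.constr_basis ℝ _ i
  have hφ' : MDifferentiableAt I 𝓘(ℝ, E →L[ℝ] ℝ) (fun y => G y (coord x σ y)) x := by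
    have h1 := T.mdifferentiableAt.comp x ((mdifferentiableAt_iff _ _).2
      ⟨continuousAt_pi.2 fun i => (hφ (b i)).continuousAt,
        differentiableWithinAt_pi.2 fun i => ((mdifferentiableAt_iff _ _).1 (hφ (b i))).2⟩)
    exact h1.congr_of_eventuallyEq (.of_forall fun y => (hT _).symm)
  rw [mdifferentiableAt_section]
  exact mdifferentiableAt_of_clm_apply hG e he hφ'

end frames

/-! ### The connection of a warped product along a map -/

section warpedMap

/-- A map `(t, F)` from a manifold to the warped product `ε ℝ ×_a Q`, where `Q` is the hyperquadric
`{β(v, v) = c}` of a space `V` with scalar product `β`. -/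
structure WarpedMap {E : Type*} [NormedAddCommGroup E] [NormedSpace ℝ E] {H : Type*}
    [TopologicalSpace H] (I : ModelWithCorners ℝ E H) (M : Type*) [TopologicalSpace M]
    [ChartedSpace H M] (V : Type*) [NormedAddCommGroup V] [NormedSpace ℝ V] where
  /-- The sign of the base. -/
  ε : ℝ
  /-- The sign of the fibre. -/
  c : ℝ
  /-- The warping function. -/
  a : ℝ → ℝ
  /-- The scalar product. -/
  β : V →L[ℝ] V →L[ℝ] ℝ
  /-- The component in the base. -/
  t : M → ℝ
  /-- The component in the fibre. -/
  F : M → V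
  ε_mul_self : ε * ε = 1
  c_mul_self : c * c = 1
  β_symm (v w : V) : β v w = β w v
  contDiffAt_a (x : M) : ContDiffAt ℝ ∞ a (t x)
  a_ne (x : M) : a (t x) ≠ 0
  contMDiff_t : ContMDiff I 𝓘(ℝ, ℝ) ∞ t
  contMDiff_F : ContMDiff I 𝓘(ℝ, V) ∞ F
  β_F (x : M) : β (F x) (F x) = c

variable {E : Type*} [NormedAddCommGroup E] [NormedSpace ℝ E]
  {H : Type*} [TopologicalSpace H] {I : ModelWithCorners ℝ E H}
  {M : Type*} [TopologicalSpace M] [ChartedSpace H M]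
  {V : Type*} [NormedAddCommGroup V] [NormedSpace ℝ V]

theorem mdifferentiableAt_comp_real {φ : ℝ → ℝ} {t : M → ℝ} {x : M}
    (hφ : DifferentiableAt ℝ φ (t x)) (ht : MDifferentiableAt I 𝓘(ℝ, ℝ) t x) :
    MDifferentiableAt I 𝓘(ℝ, ℝ) (fun y => φ (t y)) x :=
  hφ.mdifferentiableAt.comp x ht

theorem mvfderiv_comp_real {φ : ℝ → ℝ} {t : M → ℝ} {x : M}
    (hφ : DifferentiableAt ℝ φ (t x)) (ht : MDifferentiableAt I 𝓘(ℝ, ℝ) t x)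
    (v : TangentSpace I x) :
    mvfderiv I (fun y => φ (t y)) x v = deriv φ (t x) * mvfderiv I t x v := by
  have h := mfderiv_comp_apply x hφ.mdifferentiableAt ht v
  rw [mfderiv_eq_fderiv] at h
  refine h.trans ?_
  change fderiv ℝ φ (t x) (mvfderiv I t x v) = _
  generalize mvfderiv I t x v = r
  have := (fderiv ℝ φ (t x)).map_smul r 1
  simp only [smul_eq_mul, mul_one] at this
  rw [this, fderiv_apply_one_eq_deriv, mul_comm]

namespace WarpedMap

variable (D : WarpedMap I M V)

/-- The metric of the warped product at the image of `x`, as a scalar product on `ℝ × V`. -/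
def form (x : M) (s : ℝ) (z : V) (s' : ℝ) (z' : V) : ℝ :=
  D.ε * (s * s') + D.a (D.t x) ^ 2 * D.β z z'

/-- The component in the base of the covariant derivative of a vector field `(s, z)` along the
map. -/
def baseDeriv (s : M → ℝ) (z : M → V) (x : M) (v : TangentSpace I x) : ℝ :=
  mvfderiv I s x v - D.ε * (D.a (D.t x) * deriv D.a (D.t x)) * D.β (mvfderiv I D.F x v) (z x)

/-- The component in the fibre of the covariant derivative of a vector field `(s, z)` along the
map. -/
def fibreDeriv (s : M → ℝ) (z : M → V) (x : M) (v : TangentSpace I x) : V :=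
  mvfderiv I z x v + (deriv D.a (D.t x) / D.a (D.t x)) •
    (mvfderiv I D.t x v • z x + s x • mvfderiv I D.F x v) +
    (D.c * D.β (mvfderiv I D.F x v) (z x)) • D.F x

theorem mdifferentiableAt_t (x : M) : MDifferentiableAt I 𝓘(ℝ, ℝ) D.t x :=
  (D.contMDiff_t x).mdifferentiableAt (by simp)

theorem mdifferentiableAt_F (x : M) : MDifferentiableAt I 𝓘(ℝ, V) D.F x :=
  (D.contMDiff_F x).mdifferentiableAt (by simp)

theorem differentiableAt_a (x : M) : DifferentiableAt ℝ D.a (D.t x) :=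
  (D.contDiffAt_a x).differentiableAt (by simp)

theorem contDiffAt_deriv_a (x : M) : ContDiffAt ℝ ∞ (deriv D.a) (D.t x) :=
  ((D.contDiffAt_a x).fderiv_right (m := ∞) (by simp)).clm_apply contDiffAt_const

theorem differentiableAt_deriv_a (x : M) : DifferentiableAt ℝ (deriv D.a) (D.t x) :=
  (D.contDiffAt_deriv_a x).differentiableAt (by simp)

variable {D} {x : M} {s s' : M → ℝ} {z z' : M → V}

theorem mvfderiv_β (hz : MDifferentiableAt I 𝓘(ℝ, V) z x) (hz' : MDifferentiableAt I 𝓘(ℝ, V) z' x)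
    (v : TangentSpace I x) :
    mvfderiv I (fun y => D.β (z y) (z' y)) x v =
      D.β (mvfderiv I z x v) (z' x) + D.β (z x) (mvfderiv I z' x v) := by
  have h1 := mvfderiv_clm_apply (G := fun y => D.β (z y))
    (MDifferentiableAt.clm_apply (mdifferentiableAt_const (c := D.β)) hz) hz' v
  have h2 := mvfderiv_clm_apply (G := fun _ : M => D.β) (mdifferentiableAt_const) hz v
  have e0 : mvfderiv I (fun _ : M => D.β) x v = 0 := by rw [mvfderiv_const]; rfl
  rw [h1, h2, e0]
  simp

theorem mdifferentiableAt_β (hz : MDifferentiableAt I 𝓘(ℝ, V) z x)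
    (hz' : MDifferentiableAt I 𝓘(ℝ, V) z' x) :
    MDifferentiableAt I 𝓘(ℝ, ℝ) (fun y => D.β (z y) (z' y)) x :=
  (MDifferentiableAt.clm_apply (mdifferentiableAt_const (c := D.β)) hz).clm_apply hz'

theorem β_mvfderiv_F (v : TangentSpace I x) : D.β (mvfderiv I D.F x v) (D.F x) = 0 := by
  have h := mvfderiv_β (D := D) (D.mdifferentiableAt_F x) (D.mdifferentiableAt_F x) v
  rw [funext D.β_F, D.β_symm (D.F x), mvfderiv_const] at h
  simp only [_root_.zero_apply] at h
  linarith

theorem β_mvfderiv (hz : MDifferentiableAt I 𝓘(ℝ, V) z x) (hzF : ∀ y, D.β (z y) (D.F y) = 0)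
    (v : TangentSpace I x) :
    D.β (mvfderiv I z x v) (D.F x) = - D.β (mvfderiv I D.F x v) (z x) := by
  have h := mvfderiv_β (D := D) hz (D.mdifferentiableAt_F x) v
  rw [funext hzF, D.β_symm (z x), mvfderiv_const] at h
  simp only [_root_.zero_apply] at h
  linarith

/-- The multiple of `F` in `fibreDeriv` is chosen for this: differentiating β(z, F) = 0 gives β(dz,
F) = -β(dF, z), and c² = 1 makes the added term cancel it. Tangency lets the connection be applied a
second time. -/
theorem β_fibreDeriv (hz : MDifferentiableAt I 𝓘(ℝ, V) z x) (hzF : ∀ y, D.β (z y) (D.F y) = 0)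
    (v : TangentSpace I x) : D.β (D.fibreDeriv s z x v) (D.F x) = 0 := by
  have h := β_mvfderiv hz hzF v
  simp only [fibreDeriv, map_add, map_smul, add_apply, smul_apply, smul_eq_mul, h, hzF x,
    β_mvfderiv_F v, D.β_F]
  linear_combination D.β (mvfderiv I D.F x v) (z x) * D.c_mul_self

/-- Compatibility with the metric. The terms (a'/a) dt(v) z account for the derivative of a². The
base correction of each field cancels the term (a'/a) s dF(v) of the other one, by ε² = 1. The
multiples of `F` drop out by tangency at `x`. -/
theorem mvfderiv_form (hs : MDifferentiableAt I 𝓘(ℝ, ℝ) s x) (hs' : MDifferentiableAt I 𝓘(ℝ, ℝ) s' x)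
    (hz : MDifferentiableAt I 𝓘(ℝ, V) z x) (hz' : MDifferentiableAt I 𝓘(ℝ, V) z' x)
    (hzF : D.β (z x) (D.F x) = 0) (hzF' : D.β (z' x) (D.F x) = 0)
    (v : TangentSpace I x) :
    mvfderiv I (fun y => D.form y (s y) (z y) (s' y) (z' y)) x v =
      D.form x (D.baseDeriv s z x v) (D.fibreDeriv s z x v) (s' x) (z' x) +
      D.form x (s x) (z x) (D.baseDeriv s' z' x v) (D.fibreDeriv s' z' x v) := by
  have ha := mdifferentiableAt_comp_real (D.differentiableAt_a x) (D.mdifferentiableAt_t x)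
  have hb := mdifferentiableAt_β (D := D) hz hz'
  have h1 : (fun y => D.form y (s y) (z y) (s' y) (z' y)) =
      (fun _ => D.ε) * (s * s') + ((fun y => D.a (D.t y)) * (fun y => D.a (D.t y))) *
        (fun y => D.β (z y) (z' y)) := by
    funext y
    simp only [form, Pi.add_apply, Pi.mul_apply, pow_two]
  have hne := D.a_ne x
  rw [h1, mvfderiv_add (mdifferentiableAt_const.mul (hs.mul hs')) ((ha.mul ha).mul hb),
    mvfderiv_mul mdifferentiableAt_const (hs.mul hs'), mvfderiv_mul hs hs',
    mvfderiv_mul (ha.mul ha) hb, mvfderiv_mul ha ha, mvfderiv_const]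
  simp only [add_apply, smul_apply, smul_eq_mul, mvfderiv_β hz hz', Pi.mul_apply, smul_zero, add_zero,
    mvfderiv_comp_real (D.differentiableAt_a x) (D.mdifferentiableAt_t x)]
  simp only [form, baseDeriv, fibreDeriv, map_add, map_smul, add_apply, smul_apply, smul_eq_mul,
    D.β_symm (D.F x) (z' x), hzF, hzF', D.β_symm (z x) (mvfderiv I D.F x v)]
  field_simp
  linear_combination (D.a (D.t x) * deriv D.a (D.t x) * (s' x * D.β (mvfderiv I D.F x v) (z x) +
    s x * D.β (mvfderiv I D.F x v) (z' x))) * D.ε_mul_self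

theorem mdifferentiableAt_form (hs : MDifferentiableAt I 𝓘(ℝ, ℝ) s x)
    (hs' : MDifferentiableAt I 𝓘(ℝ, ℝ) s' x)
    (hz : MDifferentiableAt I 𝓘(ℝ, V) z x) (hz' : MDifferentiableAt I 𝓘(ℝ, V) z' x) :
    MDifferentiableAt I 𝓘(ℝ, ℝ) (fun y => D.form y (s y) (z y) (s' y) (z' y)) x := by
  have ha := mdifferentiableAt_comp_real (D.differentiableAt_a x) (D.mdifferentiableAt_t x)
  simp only [form, pow_two]
  exact (mdifferentiableAt_const.mul (hs.mul hs')).add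
    ((ha.mul ha).mul (mdifferentiableAt_β hz hz'))

variable [IsManifold I ∞ M]

/-- The base component of the covariant derivative of the image of a vector field. -/
abbrev baseConn (D : WarpedMap I M V) (Y : Π y : M, TangentSpace I y) (x : M)
    (v : TangentSpace I x) : ℝ :=
  D.baseDeriv (fun y => mvfderiv I D.t y (Y y)) (fun y => mvfderiv I D.F y (Y y)) x v

/-- The fibre component of the covariant derivative of the image of a vector field. -/
abbrev fibreConn (D : WarpedMap I M V) (Y : Π y : M, TangentSpace I y) (x : M)
    (v : TangentSpace I x) : V :=
  D.fibreDeriv (fun y => mvfderiv I D.t y (Y y)) (fun y => mvfderiv I D.F y (Y y)) x v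

variable {X Y Z W : Π y : M, TangentSpace I y}

/-- Absence of torsion, here and in the next lemma: on images of vector fields all correction terms
are symmetric in `X` and `Y`, so only the commutator of the derivatives of `t`, respectively `F`, is
left. -/
theorem baseConn_sub [I.Boundaryless] (hX : MDiffAt (T% X) x) (hY : MDiffAt (T% Y) x) :
    D.baseConn Y x (X x) - D.baseConn X x (Y x) =
      mvfderiv I D.t x (VectorField.mlieBracket I X Y x) := by
  rw [mvfderiv_mlieBracket D.contMDiff_t hX hY]
  simp only [baseConn, baseDeriv]
  rw [D.β_symm (mvfderiv I D.F x (X x))]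
  ring

theorem fibreConn_sub [I.Boundaryless] (hX : MDiffAt (T% X) x) (hY : MDiffAt (T% Y) x) :
    D.fibreConn Y x (X x) - D.fibreConn X x (Y x) =
      mvfderiv I D.F x (VectorField.mlieBracket I X Y x) := by
  rw [mvfderiv_mlieBracket D.contMDiff_F hX hY]
  simp only [fibreConn, fibreDeriv]
  rw [D.β_symm (mvfderiv I D.F x (X x))]
  module

/-- `g` is the metric that the map induces. -/
def Induces (D : WarpedMap I M V) (g : Metric I M) : Prop :=
  ∀ (x : M) (u v : TangentSpace I x), g.val x u v =
    D.form x (mvfderiv I D.t x u) (mvfderiv I D.F x u) (mvfderiv I D.t x v) (mvfderiv I D.F x v)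

/-- The induced connection is the tangential part of the connection of the warped product. -/
theorem Induces.val_leviCivita [I.Boundaryless] {g : Metric I M} (hg : D.Induces g)
    {C : CovariantDerivative I E (TangentSpace I : M → Type _)} (hC : IsLeviCivita g C)
    (hY : MDiffAt (T% Y) x) (v w : TangentSpace I x) :
    g.val x (C Y x v) w = D.form x (D.baseConn Y x v) (D.fibreConn Y x v)
      (mvfderiv I D.t x w) (mvfderiv I D.F x w) := by
  -- `S` is the defect of the claim. It is symmetric in its first two arguments, as both connections
  -- are torsion-free, and skew in the last two, as both are metric.
  let S (X Y Z : Π y : M, TangentSpace I y) : ℝ :=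
    D.form x (D.baseConn Y x (X x)) (D.fibreConn Y x (X x))
      (mvfderiv I D.t x (Z x)) (mvfderiv I D.F x (Z x)) - g.val x (C Y x (X x)) (Z x)
  have h1 (X Y Z : Π y : M, TangentSpace I y) (hX : MDiffAt (T% X) x) (hY : MDiffAt (T% Y) x) :
      S X Y Z = S Y X Z := by
    have e1 := baseConn_sub (D := D) hX hY
    have e2 := fibreConn_sub (D := D) hX hY
    have e3 := hC.torsion x X Y hX hY
    have e4 := hg x (VectorField.mlieBracket I X Y x) (Z x)
    rw [← e1, ← e2, ← e3] at e4
    simp only [form, map_sub, sub_apply] at e4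
    simp only [S, form]
    linear_combination -e4
  have h2 (X Y Z : Π y : M, TangentSpace I y) (hY : MDiffAt (T% Y) x) (hZ : MDiffAt (T% Z) x) :
      S X Y Z = - S X Z Y := by
    have e1 := hC.metric x Y Z hY hZ (X x)
    have e2 : (fun y => g.val y (Y y) (Z y)) = fun y => D.form y (mvfderiv I D.t y (Y y))
      (mvfderiv I D.F y (Y y)) (mvfderiv I D.t y (Z y)) (mvfderiv I D.F y (Z y)) :=
      funext fun y => hg y _ _
    rw [e2, mvfderiv_form (mdifferentiableAt_mvfderiv_field D.contMDiff_t hY)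
      (mdifferentiableAt_mvfderiv_field D.contMDiff_t hZ)
      (mdifferentiableAt_mvfderiv_field D.contMDiff_F hY)
      (mdifferentiableAt_mvfderiv_field D.contMDiff_F hZ) (β_mvfderiv_F _) (β_mvfderiv_F _)] at e1
    rw [g.symm x (Y x)] at e1
    simp only [S]
    simp only [form] at e1 ⊢
    rw [D.β_symm (D.fibreConn Z x (X x))]
    linear_combination e1
  have hd (u : TangentSpace I x) : MDiffAt (T% (FiberBundle.extend E u)) x :=
    FiberBundle.mdifferentiableAt_extend I E u
  have h3 (X Y Z : Π y : M, TangentSpace I y) (hX : MDiffAt (T% X) x) (hY : MDiffAt (T% Y) x)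
      (hZ : MDiffAt (T% Z) x) : S X Y Z = 0 := by
    -- Six alternate swaps lead back to `S X Y Z` with three changes of sign, so it equals its
    -- negative.
    have a1 := h1 X Y Z hX hY
    have a2 := h2 Y X Z hX hZ
    have a3 := h1 Y Z X hY hZ
    have a4 := h2 Z Y X hY hX
    have a5 := h1 Z X Y hZ hX
    have a6 := h2 X Z Y hZ hY
    linarith
  have := h3 (FiberBundle.extend E v) Y (FiberBundle.extend E w) (hd v) hY (hd w)
  simp only [S, FiberBundle.extend_apply_self] at this
  linarith


section smooth

variable (hs : ContMDiff I 𝓘(ℝ, ℝ) ∞ s) (hz : ContMDiff I 𝓘(ℝ, V) ∞ z)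
include hs hz

theorem mdifferentiableAt_baseDeriv (hY : IsSmoothField I Y) :
    MDifferentiableAt I 𝓘(ℝ, ℝ) (fun y => D.baseDeriv s z y (Y y)) x := by
  have ha := mdifferentiableAt_comp_real (D.differentiableAt_a x) (D.mdifferentiableAt_t x)
  have ha' := mdifferentiableAt_comp_real (D.differentiableAt_deriv_a x) (D.mdifferentiableAt_t x)
  exact (mdifferentiableAt_mvfderiv_field hs (hY.mdifferentiableAt x)).sub
    ((mdifferentiableAt_const.mul (ha.mul ha')).mul
      (mdifferentiableAt_β (mdifferentiableAt_mvfderiv_field D.contMDiff_F (hY.mdifferentiableAt x))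
        ((hz x).mdifferentiableAt (by simp))))

theorem mdifferentiableAt_fibreDeriv (hY : IsSmoothField I Y) :
    MDifferentiableAt I 𝓘(ℝ, V) (fun y => D.fibreDeriv s z y (Y y)) x := by
  have hφ : MDifferentiableAt I 𝓘(ℝ, ℝ) (fun y => deriv D.a (D.t y) / D.a (D.t y)) x :=
    mdifferentiableAt_comp_real (φ := fun r => deriv D.a r / D.a r)
      ((D.differentiableAt_deriv_a x).div (D.differentiableAt_a x) (D.a_ne x))
      (D.mdifferentiableAt_t x)
  have hYF := mdifferentiableAt_mvfderiv_field D.contMDiff_F (hY.mdifferentiableAt x)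
  have hYt := mdifferentiableAt_mvfderiv_field D.contMDiff_t (hY.mdifferentiableAt x)
  have hs' := (hs x).mdifferentiableAt (by simp)
  have hz' := (hz x).mdifferentiableAt (by simp)
  exact ((mdifferentiableAt_mvfderiv_field hz (hY.mdifferentiableAt x)).add
    (hφ.smul ((hYt.smul hz').add (hs'.smul hYF)))).add
      ((mdifferentiableAt_const.mul (mdifferentiableAt_β hYF hz')).smul (D.mdifferentiableAt_F x))

/-- In this lemma and the next, second derivatives stay in the form of iterated derivatives along
fields, which `mvfderiv_mlieBracket` can cancel in the curvature. -/
theorem mvfderiv_baseDeriv (hY : IsSmoothField I Y) (v : TangentSpace I x) :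
    mvfderiv I (fun y => D.baseDeriv s z y (Y y)) x v =
      mvfderiv I (fun y => mvfderiv I s y (Y y)) x v -
      D.ε * (deriv D.a (D.t x) ^ 2 + D.a (D.t x) * deriv (deriv D.a) (D.t x)) *
        mvfderiv I D.t x v * D.β (mvfderiv I D.F x (Y x)) (z x) -
      D.ε * (D.a (D.t x) * deriv D.a (D.t x)) *
        (D.β (mvfderiv I (fun y => mvfderiv I D.F y (Y y)) x v) (z x) +
          D.β (mvfderiv I D.F x (Y x)) (mvfderiv I z x v)) := by
  have hd := (D.differentiableAt_a x).mul (D.differentiableAt_deriv_a x)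
  have hφ := mdifferentiableAt_comp_real hd (D.mdifferentiableAt_t x)
  have hφ' := mvfderiv_comp_real hd (D.mdifferentiableAt_t x) v
  rw [deriv_mul (D.differentiableAt_a x) (D.differentiableAt_deriv_a x)] at hφ'
  simp only [Pi.mul_apply] at hφ'
  have hYF := mdifferentiableAt_mvfderiv_field D.contMDiff_F (hY.mdifferentiableAt x)
  have hz' : MDifferentiableAt I 𝓘(ℝ, V) z x := (hz x).mdifferentiableAt (by simp)
  have hβ := mdifferentiableAt_β (D := D) hYF hz'
  have h1 : (fun y => D.baseDeriv s z y (Y y)) = (fun y => mvfderiv I s y (Y y)) -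
      (fun _ => D.ε) * ((fun y => (D.a * deriv D.a) (D.t y)) *
        (fun y => D.β (mvfderiv I D.F y (Y y)) (z y))) := by
    funext y
    simp only [baseDeriv, Pi.sub_apply, Pi.mul_apply]
    ring
  rw [h1, mvfderiv_sub (mdifferentiableAt_mvfderiv_field hs (hY.mdifferentiableAt x))
    (mdifferentiableAt_const.mul (hφ.mul hβ)), mvfderiv_mul mdifferentiableAt_const (hφ.mul hβ),
    mvfderiv_mul hφ hβ, mvfderiv_const]
  simp only [sub_apply, add_apply, smul_apply, smul_eq_mul, hφ', mvfderiv_β hYF hz',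
    Pi.mul_apply, smul_zero, add_zero]
  ring

theorem mvfderiv_fibreDeriv (hY : IsSmoothField I Y) (v : TangentSpace I x) :
    mvfderiv I (fun y => D.fibreDeriv s z y (Y y)) x v =
      mvfderiv I (fun y => mvfderiv I z y (Y y)) x v +
      ((deriv (deriv D.a) (D.t x) / D.a (D.t x) - (deriv D.a (D.t x) / D.a (D.t x)) ^ 2) *
        mvfderiv I D.t x v) •
        (mvfderiv I D.t x (Y x) • z x + s x • mvfderiv I D.F x (Y x)) +
      (deriv D.a (D.t x) / D.a (D.t x)) •
        (mvfderiv I (fun y => mvfderiv I D.t y (Y y)) x v • z x +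
          mvfderiv I D.t x (Y x) • mvfderiv I z x v + mvfderiv I s x v • mvfderiv I D.F x (Y x) +
          s x • mvfderiv I (fun y => mvfderiv I D.F y (Y y)) x v) +
      (D.c * (D.β (mvfderiv I (fun y => mvfderiv I D.F y (Y y)) x v) (z x) +
          D.β (mvfderiv I D.F x (Y x)) (mvfderiv I z x v))) • D.F x +
      (D.c * D.β (mvfderiv I D.F x (Y x)) (z x)) • mvfderiv I D.F x v := by
  have hd := (D.differentiableAt_deriv_a x).div (D.differentiableAt_a x) (D.a_ne x)
  have hφ := mdifferentiableAt_comp_real hd (D.mdifferentiableAt_t x)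
  have hφ' := mvfderiv_comp_real hd (D.mdifferentiableAt_t x) v
  rw [deriv_div (D.differentiableAt_deriv_a x) (D.differentiableAt_a x) (D.a_ne x)] at hφ'
  simp only [Pi.div_apply] at hφ'
  have hYF := mdifferentiableAt_mvfderiv_field D.contMDiff_F (hY.mdifferentiableAt x)
  have hYt := mdifferentiableAt_mvfderiv_field D.contMDiff_t (hY.mdifferentiableAt x)
  have hs' : MDifferentiableAt I 𝓘(ℝ, ℝ) s x := (hs x).mdifferentiableAt (by simp)
  have hz' : MDifferentiableAt I 𝓘(ℝ, V) z x := (hz x).mdifferentiableAt (by simp)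
  have hβ := mdifferentiableAt_β (D := D) hYF hz'
  have hYz := mdifferentiableAt_mvfderiv_field hz (hY.mdifferentiableAt x)
  have hc : MDifferentiableAt I 𝓘(ℝ, ℝ) (fun _ : M => D.c) x := mdifferentiableAt_const
  have h1 : (fun y => D.fibreDeriv s z y (Y y)) = ((fun y => mvfderiv I z y (Y y)) +
      (fun y => (deriv D.a / D.a) (D.t y)) • ((fun y => mvfderiv I D.t y (Y y)) • z +
        s • (fun y => mvfderiv I D.F y (Y y)))) +
      ((fun _ => D.c) * (fun y => D.β (mvfderiv I D.F y (Y y)) (z y))) • D.F := by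
    funext y
    simp only [fibreDeriv, Pi.add_apply, Pi.mul_apply, Pi.smul_apply', Pi.div_apply]
  have hsum := (hYt.smul hz').add (hs'.smul hYF)
  rw [h1, mvfderiv_add (hYz.add (hφ.smul hsum)) ((hc.mul hβ).smul (D.mdifferentiableAt_F x)),
    mvfderiv_add hYz (hφ.smul hsum), mvfderiv_smul hφ hsum, mvfderiv_add (hYt.smul hz')
    (hs'.smul hYF), mvfderiv_smul hYt hz', mvfderiv_smul hs' hYF,
    mvfderiv_smul (hc.mul hβ) (D.mdifferentiableAt_F x), mvfderiv_mul hc hβ, mvfderiv_const]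
  simp only [add_apply, smul_apply, smul_eq_mul, hφ', mvfderiv_β hYF hz',
    ContinuousLinearMap.smulRight_apply, Pi.add_apply, Pi.smul_apply', Pi.mul_apply, smul_zero,
    add_zero, Pi.div_apply]
  have hne := D.a_ne x
  have e : (deriv (deriv D.a) (D.t x) * D.a (D.t x) - deriv D.a (D.t x) * deriv D.a (D.t x)) /
      D.a (D.t x) ^ 2 = deriv (deriv D.a) (D.t x) / D.a (D.t x) -
        (deriv D.a (D.t x) / D.a (D.t x)) ^ 2 := by
    field_simp
  rw [e]
  module

end smooth

/-- The Levi-Civita connection of an induced metric preserves smooth vector fields. -/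
theorem Induces.mdifferentiableAt_leviCivita [FiniteDimensional ℝ E] [I.Boundaryless]
    {g : Metric I M} (hg : D.Induces g)
    {C : CovariantDerivative I E (TangentSpace I : M → Type _)} (hC : IsLeviCivita g C)
    (hY : IsSmoothField I Y) (hZ : IsSmoothField I Z) (x : M) :
    MDiffAt (T% (fun y => C Z y (Y y))) x := by
  -- A covariant derivative carries no regularity of its own. The scalar products of `C Z` with a
  -- frame, however, are given by the explicit formula, whose differentiability is visible.
  refine g.mdifferentiableAt_of_val fun w => ?_
  have hw : MDiffAt (T% (FiberBundle.extend E w)) x := FiberBundle.mdifferentiableAt_extend I E w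
  refine (mdifferentiableAt_form (D := D)
    (mdifferentiableAt_baseDeriv (D := D) (contMDiff_mvfderiv_field D.contMDiff_t hZ)
      (contMDiff_mvfderiv_field D.contMDiff_F hZ) hY)
    (mdifferentiableAt_mvfderiv_field D.contMDiff_t hw)
    (mdifferentiableAt_fibreDeriv (D := D) (contMDiff_mvfderiv_field D.contMDiff_t hZ)
      (contMDiff_mvfderiv_field D.contMDiff_F hZ) hY)
    (mdifferentiableAt_mvfderiv_field D.contMDiff_F hw)).congr_of_eventuallyEq
      (.of_forall fun y => ?_)
  exact hg.val_leviCivita hC (hZ.mdifferentiableAt y) _ _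

end WarpedMap

end warpedMap

/-! ### The ambient curvature and the Gauss equation of an induced metric -/

section gauss

variable {E : Type*} [NormedAddCommGroup E] [NormedSpace ℝ E]
  {H : Type*} [TopologicalSpace H] {I : ModelWithCorners ℝ E H}
  {M : Type*} [TopologicalSpace M] [ChartedSpace H M] [IsManifold I ∞ M]
  {V : Type*} [NormedAddCommGroup V] [NormedSpace ℝ V]

namespace WarpedMap

variable {D : WarpedMap I M V} {x : M} {s : M → ℝ} {z : M → V} {X Y Z W : Π y : M, TangentSpace I y}

/-- The curvature of the warped product, on vector fields along the map. -/
theorem form_curvature [I.Boundaryless] (hs : ContMDiff I 𝓘(ℝ, ℝ) ∞ s)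
    (hz : ContMDiff I 𝓘(ℝ, V) ∞ z)
    (hX : IsSmoothField I X) (hY : IsSmoothField I Y)
    (s' : ℝ) (z' : V) (hz' : D.β z' (D.F x) = 0) :
    D.form x
      (D.baseDeriv (fun y => D.baseDeriv s z y (Y y)) (fun y => D.fibreDeriv s z y (Y y)) x (X x))
      (D.fibreDeriv (fun y => D.baseDeriv s z y (Y y)) (fun y => D.fibreDeriv s z y (Y y)) x (X x))
      s' z' -
    D.form x
      (D.baseDeriv (fun y => D.baseDeriv s z y (X y)) (fun y => D.fibreDeriv s z y (X y)) x (Y x))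
      (D.fibreDeriv (fun y => D.baseDeriv s z y (X y)) (fun y => D.fibreDeriv s z y (X y)) x (Y x))
      s' z' -
    D.form x (D.baseDeriv s z x (VectorField.mlieBracket I X Y x))
      (D.fibreDeriv s z x (VectorField.mlieBracket I X Y x)) s' z' =
    (D.ε * deriv D.a (D.t x) ^ 2 / D.a (D.t x) ^ 2 - D.c / D.a (D.t x) ^ 2) *
      (D.form x (mvfderiv I D.t x (X x)) (mvfderiv I D.F x (X x)) (s x) (z x) *
        D.form x (mvfderiv I D.t x (Y x)) (mvfderiv I D.F x (Y x)) s' z' -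
      D.form x (mvfderiv I D.t x (Y x)) (mvfderiv I D.F x (Y x)) (s x) (z x) *
        D.form x (mvfderiv I D.t x (X x)) (mvfderiv I D.F x (X x)) s' z') +
    (deriv (deriv D.a) (D.t x) / D.a (D.t x) - deriv D.a (D.t x) ^ 2 / D.a (D.t x) ^ 2 +
        D.ε * D.c / D.a (D.t x) ^ 2) *
      (D.form x (mvfderiv I D.t x (X x)) (mvfderiv I D.F x (X x)) (s x) (z x) *
          mvfderiv I D.t x (Y x) * s' -
        D.form x (mvfderiv I D.t x (Y x)) (mvfderiv I D.F x (Y x)) (s x) (z x) *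
          mvfderiv I D.t x (X x) * s' -
        D.form x (mvfderiv I D.t x (X x)) (mvfderiv I D.F x (X x)) s' z' *
          mvfderiv I D.t x (Y x) * s x +
        D.form x (mvfderiv I D.t x (Y x)) (mvfderiv I D.F x (Y x)) s' z' *
          mvfderiv I D.t x (X x) * s x) := by
  have hXd := hX.mdifferentiableAt x
  have hYd := hY.mdifferentiableAt x
  have e1 := mvfderiv_mlieBracket hs hXd hYd
  have e2 := mvfderiv_mlieBracket hz hXd hYd
  have e3 := mvfderiv_mlieBracket D.contMDiff_t hXd hYd
  have e4 := mvfderiv_mlieBracket D.contMDiff_F hXd hYd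
  have f1 := mvfderiv_baseDeriv (D := D) hs hz hY (X x)
  have f2 := mvfderiv_baseDeriv (D := D) hs hz hX (Y x)
  have f3 := mvfderiv_fibreDeriv (D := D) hs hz hY (X x)
  have f4 := mvfderiv_fibreDeriv (D := D) hs hz hX (Y x)
  have g1 := β_mvfderiv_F (D := D) (X x)
  have g2 := β_mvfderiv_F (D := D) (Y x)
  have hne := D.a_ne x
  have hsy := D.β_symm
  have g5 : D.β (D.F x) z' = 0 := (hsy _ _).trans hz'
  have g7 := hsy (mvfderiv I D.F x (X x)) (mvfderiv I D.F x (Y x))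
  -- These unfold the connection at the point `x` only. The inner fields, at a variable point, stay
  -- folded and match `f1`, …, `f4`.
  have hb (s z v) : D.baseDeriv s z x v = mvfderiv I s x v - D.ε * (D.a (D.t x) *
    deriv D.a (D.t x)) * D.β (mvfderiv I D.F x v) (z x) := rfl
  have hf (s z v) : D.fibreDeriv s z x v = mvfderiv I z x v + (deriv D.a (D.t x) / D.a (D.t x)) •
    (mvfderiv I D.t x v • z x + s x • mvfderiv I D.F x v) +
    (D.c * D.β (mvfderiv I D.F x v) (z x)) • D.F x := rfl
  simp only [hb, hf, f1, f2, f3, f4, e1, e2, e3, e4]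
  simp only [form, map_add, map_sub, map_smul, add_apply, sub_apply, smul_apply, smul_eq_mul, g1, g2,
    g5, g7]
  -- The two values of ε encode ε² = 1. The sign c needs no such treatment: once the terms along
  -- `D.F x` vanish, it occurs only linearly.
  rcases mul_self_eq_one_iff.1 D.ε_mul_self with hε | hε
  all_goals
    rw [hε]
    field_simp
    ring

/-- The Gauss equation for the metric that a map to a warped product induces. -/
theorem Induces.curvatureTensor_eq [FiniteDimensional ℝ E] [I.Boundaryless] {g : Metric I M}
    (hg : D.Induces g) (hX : IsSmoothField I X) (hY : IsSmoothField I Y) (hZ : IsSmoothField I Z)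
    (hW : IsSmoothField I W) (x : M) :
    g.curvatureTensor X Y Z W x =
      (D.ε * deriv D.a (D.t x) ^ 2 / D.a (D.t x) ^ 2 - D.c / D.a (D.t x) ^ 2) *
        (g.val x (X x) (Z x) * g.val x (Y x) (W x) - g.val x (Y x) (Z x) * g.val x (X x) (W x)) +
      (deriv (deriv D.a) (D.t x) / D.a (D.t x) - deriv D.a (D.t x) ^ 2 / D.a (D.t x) ^ 2 +
          D.ε * D.c / D.a (D.t x) ^ 2) *
        (g.val x (X x) (Z x) * mvfderiv I D.t x (Y x) * mvfderiv I D.t x (W x) -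
          g.val x (Y x) (Z x) * mvfderiv I D.t x (X x) * mvfderiv I D.t x (W x) -
          g.val x (X x) (W x) * mvfderiv I D.t x (Y x) * mvfderiv I D.t x (Z x) +
          g.val x (Y x) (W x) * mvfderiv I D.t x (X x) * mvfderiv I D.t x (Z x)) -
      (D.form x (D.baseConn Z x (X x)) (D.fibreConn Z x (X x))
          (D.baseConn W x (Y x)) (D.fibreConn W x (Y x)) -
        g.val x (g.leviCivita Z x (X x)) (g.leviCivita W x (Y x))) +
      (D.form x (D.baseConn Z x (Y x)) (D.fibreConn Z x (Y x))
          (D.baseConn W x (X x)) (D.fibreConn W x (X x)) -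
        g.val x (g.leviCivita Z x (Y x)) (g.leviCivita W x (X x))) := by
  have hC := g.isLeviCivita_leviCivita
  have hst := contMDiff_mvfderiv_field D.contMDiff_t hZ
  have hsF := contMDiff_mvfderiv_field D.contMDiff_F hZ
  -- The relation ⟨∇_Y Z, W⟩ = ⟨D_Y Z, W⟩ is differentiated along `X` by the metric rule of each
  -- connection. No derivative of a normal field, hence no Weingarten formula, is needed.
  have key (X Y : Π y : M, TangentSpace I y) (hY : IsSmoothField I Y) :
      g.val x (g.leviCivita (fun y => g.leviCivita Z y (Y y)) x (X x)) (W x) =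
        D.form x (D.baseDeriv (fun y => D.baseConn Z y (Y y)) (fun y => D.fibreConn Z y (Y y)) x (X x))
          (D.fibreDeriv (fun y => D.baseConn Z y (Y y)) (fun y => D.fibreConn Z y (Y y)) x (X x))
          (mvfderiv I D.t x (W x)) (mvfderiv I D.F x (W x)) +
        (D.form x (D.baseConn Z x (Y x)) (D.fibreConn Z x (Y x))
          (D.baseConn W x (X x)) (D.fibreConn W x (X x)) -
        g.val x (g.leviCivita Z x (Y x)) (g.leviCivita W x (X x))) := by
    have h1 := hC.metric x _ W (hg.mdifferentiableAt_leviCivita hC hY hZ x)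
      (hW.mdifferentiableAt x) (X x)
    have h2 : (fun y => g.val y (g.leviCivita Z y (Y y)) (W y)) = fun y =>
        D.form y (D.baseConn Z y (Y y)) (D.fibreConn Z y (Y y))
          (mvfderiv I D.t y (W y)) (mvfderiv I D.F y (W y)) :=
      funext fun y => hg.val_leviCivita hC (hZ.mdifferentiableAt y) _ _
    rw [h2, mvfderiv_form (mdifferentiableAt_baseDeriv hst hsF hY)
      (mdifferentiableAt_mvfderiv_field D.contMDiff_t (hW.mdifferentiableAt x))
      (mdifferentiableAt_fibreDeriv hst hsF hY)
      (mdifferentiableAt_mvfderiv_field D.contMDiff_F (hW.mdifferentiableAt x))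
      (β_fibreDeriv ((hsF x).mdifferentiableAt (by simp)) (fun y => β_mvfderiv_F _) _)
      (β_mvfderiv_F _)] at h1
    linear_combination -h1
  have hcurv := form_curvature (D := D) (x := x) hst hsF hX hY
    (mvfderiv I D.t x (W x)) (mvfderiv I D.F x (W x)) (β_mvfderiv_F (W x))
  have hbr := hg.val_leviCivita hC (hZ.mdifferentiableAt x) (VectorField.mlieBracket I X Y x) (W x)
  have k1 := key X Y hY
  have k2 := key Y X hX
  simp only [Metric.curvatureTensor, curvature, map_sub, sub_apply]
  rw [k1, k2, hbr]
  simp only [← hg x] at hcurv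
  linear_combination hcurv

end WarpedMap

end gauss

/-! ### The second fundamental form in components -/

section immersion

variable {E : Type*} [NormedAddCommGroup E] [NormedSpace ℝ E]
  {H : Type*} [TopologicalSpace H] {I : ModelWithCorners ℝ E H}
  {M : Type*} [TopologicalSpace M] [ChartedSpace H M] [IsManifold I ∞ M]
  {E₂ : Type*} [NormedAddCommGroup E₂] [NormedSpace ℝ E₂]
  {H₂ : Type*} [TopologicalSpace H₂] {I₂ : ModelWithCorners ℝ E₂ H₂}
  {M₂ : Type*} [TopologicalSpace M₂] [ChartedSpace H₂ M₂] [IsManifold I₂ ∞ M₂]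
  {V : Type*} [NormedAddCommGroup V] [NormedSpace ℝ V]

theorem mdifferentiableAt_mfderiv_field {f : M → M₂} (hf : ContMDiff I I₂ ∞ f)
    {Y : Π y : M, TangentSpace I y} {x : M} (hY : MDiffAt (T% Y) x) :
    MDifferentiableAt I I₂.tangent
      (fun y => (⟨f y, mfderiv I I₂ f y (Y y)⟩ : TangentBundle I₂ M₂)) x :=
  (((hf.contMDiff_tangentMap (m := ∞) (by simp)) ⟨x, Y x⟩).mdifferentiableAt (by simp)).comp x hY

theorem tangentialPart_eq [FiniteDimensional ℝ E] (g : Metric I M) (g₂ : Metric I₂ M₂) (f : M → M₂)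
    (x : M) (w : TangentSpace I₂ (f x)) (v : TangentSpace I x)
    (h : ∀ u, g.val x v u = g₂.val (f x) w (mfderiv I I₂ f x u)) :
    tangentialPart g g₂ f x w = v := by
  rw [← sub_eq_zero]
  refine g.nondegenerate x _ fun u => ?_
  rw [map_sub, sub_apply, h, tangentialPart, g.val_sharp]
  exact sub_self _

/-- Pythagoras: both mixed products and the product of the two tangential vectors equal the
`g`-product of the tangential parts, so one copy remains with a minus sign. -/
theorem IsIsometricImmersion.val_normalPart [FiniteDimensional ℝ E] {g : Metric I M}
    {g₂ : Metric I₂ M₂} {f : M → M₂} (hf : IsIsometricImmersion g g₂ f) (x : M)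
    (w w' : TangentSpace I₂ (f x)) :
    g₂.val (f x) (normalPart g g₂ f x w) (normalPart g g₂ f x w') =
      g₂.val (f x) w w' - g.val x (tangentialPart g g₂ f x w) (tangentialPart g g₂ f x w') := by
  have h (w : TangentSpace I₂ (f x)) (u : TangentSpace I x) :
      g₂.val (f x) w (mfderiv I I₂ f x u) = g.val x (tangentialPart g g₂ f x w) u := by
    rw [tangentialPart, g.val_sharp]
    rfl
  simp only [normalPart, map_sub, sub_apply, hf.isometric, h]
  rw [g₂.symm _ (mfderiv I I₂ f x (tangentialPart g g₂ f x w)) w', h, g.symm _ _ (tangentialPart g g₂ f x w)]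
  ring

namespace WarpedMap

/-- The composition of a map to a warped product with a smooth map. -/
def comp (D : WarpedMap I₂ M₂ V) {f : M → M₂} (hf : ContMDiff I I₂ ∞ f) : WarpedMap I M V where
  ε := D.ε
  c := D.c
  a := D.a
  β := D.β
  t y := D.t (f y)
  F y := D.F (f y)
  ε_mul_self := D.ε_mul_self
  c_mul_self := D.c_mul_self
  β_symm := D.β_symm
  contDiffAt_a y := D.contDiffAt_a (f y)
  a_ne y := D.a_ne (f y)
  contMDiff_t := D.contMDiff_t.comp hf
  contMDiff_F := D.contMDiff_F.comp hf
  β_F y := D.β_F (f y)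

/-- The tangent spaces are mapped onto those of the warped product. -/
def Submersive (D : WarpedMap I₂ M₂ V) : Prop :=
  ∀ (q : M₂) (r : ℝ) (w : V), D.β w (D.F q) = 0 →
    ∃ u : TangentSpace I₂ q, mvfderiv I₂ D.t q u = r ∧ mvfderiv I₂ D.F q u = w

variable {D : WarpedMap I₂ M₂ V}

/-- `Induces.val_leviCivita` sees only the tangential part of the explicit connection. Under
`Submersive` nothing is lost: some tangent vector has these components, and nondegeneracy identifies
it with `C Y q v`. -/
theorem Induces.mvfderiv_leviCivita [I₂.Boundaryless] {g₂ : Metric I₂ M₂} (hg : D.Induces g₂)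
    (hD : D.Submersive)
    {C : CovariantDerivative I₂ E₂ (TangentSpace I₂ : M₂ → Type _)} (hC : IsLeviCivita g₂ C)
    {q : M₂} {Y : Π y : M₂, TangentSpace I₂ y} (hY : MDiffAt (T% Y) q) (v : TangentSpace I₂ q) :
    mvfderiv I₂ D.t q (C Y q v) = D.baseConn Y q v ∧
      mvfderiv I₂ D.F q (C Y q v) = D.fibreConn Y q v := by
  obtain ⟨u, hu1, hu2⟩ := hD q (D.baseConn Y q v) (D.fibreConn Y q v)
    (β_fibreDeriv (mdifferentiableAt_mvfderiv_field D.contMDiff_F hY)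
      (fun y => β_mvfderiv_F (Y y)) v)
  have h : C Y q v = u := by
    rw [← sub_eq_zero]
    refine g₂.nondegenerate q _ fun w => ?_
    rw [map_sub, sub_apply, hg.val_leviCivita hC hY, hg, hu1, hu2, sub_self]
  rw [h]
  exact ⟨hu1, hu2⟩

omit [IsManifold I ∞ M] [IsManifold I₂ ∞ M₂] in
theorem mvfderiv_comp_t {f : M → M₂} (hf : ContMDiff I I₂ ∞ f) (x : M) (v : TangentSpace I x) :
    mvfderiv I (D.comp hf).t x v = mvfderiv I₂ D.t (f x) (mfderiv I I₂ f x v) :=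
  mvfderiv_comp_map (D.mdifferentiableAt_t (f x)) ((hf x).mdifferentiableAt (by simp)) v

omit [IsManifold I ∞ M] [IsManifold I₂ ∞ M₂] in
theorem mvfderiv_comp_F {f : M → M₂} (hf : ContMDiff I I₂ ∞ f) (x : M) (v : TangentSpace I x) :
    mvfderiv I (D.comp hf).F x v = mvfderiv I₂ D.F (f x) (mfderiv I I₂ f x v) :=
  mvfderiv_comp_map (D.mdifferentiableAt_F (f x)) ((hf x).mdifferentiableAt (by simp)) v

omit [IsManifold I ∞ M] [IsManifold I₂ ∞ M₂] in
-- The corrections depend on the direction only through `df v`, so they are the ambient ones at `f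
-- x`. This allows the comparison with `covDerivAlong`.
theorem comp_baseDeriv {f : M → M₂} (hf : ContMDiff I I₂ ∞ f) (s : M → ℝ) (z : M → V) (x : M)
    (v : TangentSpace I x) :
    (D.comp hf).baseDeriv s z x v = mvfderiv I s x v -
      D.ε * (D.a (D.t (f x)) * deriv D.a (D.t (f x))) *
        D.β (mvfderiv I₂ D.F (f x) (mfderiv I I₂ f x v)) (z x) := by
  rw [← mvfderiv_comp_F hf]
  rfl

omit [IsManifold I ∞ M] [IsManifold I₂ ∞ M₂] in
theorem comp_fibreDeriv {f : M → M₂} (hf : ContMDiff I I₂ ∞ f) (s : M → ℝ) (z : M → V) (x : M)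
    (v : TangentSpace I x) :
    (D.comp hf).fibreDeriv s z x v = mvfderiv I z x v +
      (deriv D.a (D.t (f x)) / D.a (D.t (f x))) •
        (mvfderiv I₂ D.t (f x) (mfderiv I I₂ f x v) • z x +
          s x • mvfderiv I₂ D.F (f x) (mfderiv I I₂ f x v)) +
      (D.c * D.β (mvfderiv I₂ D.F (f x) (mfderiv I I₂ f x v)) (z x)) • D.F (f x) := by
  rw [← mvfderiv_comp_F hf, ← mvfderiv_comp_t hf]
  rfl

/-- The components of the covariant derivative of a vector field along `f`. -/
theorem Induces.mvfderiv_covDerivAlong [I₂.Boundaryless] {g₂ : Metric I₂ M₂} (hg : D.Induces g₂)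
    (hD : D.Submersive)
    {C : CovariantDerivative I₂ E₂ (TangentSpace I₂ : M₂ → Type _)} (hC : IsLeviCivita g₂ C)
    {f : M → M₂} (hf : ContMDiff I I₂ ∞ f) {x : M} {U : Π y : M, TangentSpace I₂ (f y)}
    (hU : MDifferentiableAt I I₂.tangent (fun y => (⟨f y, U y⟩ : TangentBundle I₂ M₂)) x)
    (v : TangentSpace I x) :
    mvfderiv I₂ D.t (f x) (covDerivAlong I C f U x v) =
      (D.comp hf).baseDeriv (fun y => mvfderiv I₂ D.t (f y) (U y))
        (fun y => mvfderiv I₂ D.F (f y) (U y)) x v ∧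
    mvfderiv I₂ D.F (f x) (covDerivAlong I C f U x v) =
      (D.comp hf).fibreDeriv (fun y => mvfderiv I₂ D.t (f y) (U y))
        (fun y => mvfderiv I₂ D.F (f y) (U y)) x v := by
  -- The ambient connection acts on the field with frozen coefficients. The derivative of the
  -- coefficients is supplied by `h3` and `h4`, and the corrections agree because the frozen field
  -- has the value `U x` at `f x`.
  obtain ⟨h1, h2⟩ := hg.mvfderiv_leviCivita hD hC
    (FiberBundle.mdifferentiableAt_extend I₂ E₂ (U x)) (mfderiv I I₂ f x v)
  have h3 := mvfderiv_mvfderiv_along D.contMDiff_t hU v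
  have h4 := mvfderiv_mvfderiv_along D.contMDiff_F hU v
  constructor
  · rw [covDerivAlong, map_add, h1, comp_baseDeriv, h3]
    simp only [baseConn, baseDeriv, FiberBundle.extend_apply_self]
    ring
  · rw [covDerivAlong, map_add, h2, comp_fibreDeriv, h4]
    simp only [fibreConn, fibreDeriv, FiberBundle.extend_apply_self]
    module

theorem Induces.comp [FiniteDimensional ℝ E] {g : Metric I M} {g₂ : Metric I₂ M₂}
    (hg : D.Induces g₂) {f : M → M₂} (hf : IsIsometricImmersion g g₂ f) :
    (D.comp hf.contMDiff).Induces g := by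
  intro x u v
  rw [← hf.isometric, hg, mvfderiv_comp_t, mvfderiv_comp_F, mvfderiv_comp_t, mvfderiv_comp_F]
  rfl

/-- The ambient derivative of `df(Z)` has the explicit components, and its tangential part is the
connection of `M`, by `Induces.val_leviCivita` for the composed map. Pythagoras then gives precisely
the differences that occur in `Induces.curvatureTensor_eq`. -/
theorem Induces.val_secondFundamentalForm [FiniteDimensional ℝ E] [FiniteDimensional ℝ E₂]
    [I.Boundaryless] [I₂.Boundaryless] {g : Metric I M} {g₂ : Metric I₂ M₂}
    (hg : D.Induces g₂) (hD : D.Submersive) {f : M → M₂} (hf : IsIsometricImmersion g g₂ f)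
    {X Y Z W : Π y : M, TangentSpace I y} {x : M} (hZ : MDiffAt (T% Z) x) (hW : MDiffAt (T% W) x) :
    g₂.val (f x) (secondFundamentalForm g g₂ f X Z x) (secondFundamentalForm g g₂ f Y W x) =
      (D.comp hf.contMDiff).form x ((D.comp hf.contMDiff).baseConn Z x (X x))
        ((D.comp hf.contMDiff).fibreConn Z x (X x)) ((D.comp hf.contMDiff).baseConn W x (Y x))
        ((D.comp hf.contMDiff).fibreConn W x (Y x)) -
      g.val x (g.leviCivita Z x (X x)) (g.leviCivita W x (Y x)) := by
  have hc := hf.contMDiff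
  have hcov {Y : Π y : M, TangentSpace I y} (hY : MDiffAt (T% Y) x) (v : TangentSpace I x) :
      mvfderiv I₂ D.t (f x)
        (covDerivAlong I g₂.leviCivita f (fun y => mfderiv I I₂ f y (Y y)) x v) =
          (D.comp hc).baseConn Y x v ∧
      mvfderiv I₂ D.F (f x)
        (covDerivAlong I g₂.leviCivita f (fun y => mfderiv I I₂ f y (Y y)) x v) =
          (D.comp hc).fibreConn Y x v := by
    have := hg.mvfderiv_covDerivAlong hD g₂.isLeviCivita_leviCivita hc
      (mdifferentiableAt_mfderiv_field hc hY) v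
    simpa only [← mvfderiv_comp_t hc, ← mvfderiv_comp_F hc] using this
  have htan {Y : Π y : M, TangentSpace I y} (hY : MDiffAt (T% Y) x) (v : TangentSpace I x) :
      tangentialPart g g₂ f x
        (covDerivAlong I g₂.leviCivita f (fun y => mfderiv I I₂ f y (Y y)) x v) =
        g.leviCivita Y x v := by
    refine tangentialPart_eq _ _ _ _ _ _ fun u => ?_
    rw [(hg.comp hf).val_leviCivita g.isLeviCivita_leviCivita hY, hg, (hcov hY v).1, (hcov hY v).2,
      mvfderiv_comp_t, mvfderiv_comp_F]
    rfl
  rw [secondFundamentalForm, secondFundamentalForm, hf.val_normalPart, htan hZ, htan hW, hg,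
    (hcov hZ _).1, (hcov hZ _).2, (hcov hW _).1, (hcov hW _).2]
  rfl

end WarpedMap

end immersion

/-! ### The warped product over an interval as an instance -/

section warped

variable {N l : ℕ} {c : ℤˣ} {J : TopologicalSpace.Opens ℝ} {o : hyperquadric N l c}

theorem units_cast_mul_self (u : ℤˣ) : ((u : ℤ) : ℝ) * ((u : ℤ) : ℝ) = 1 := by
  rcases Int.units_eq_one_or u with rfl | rfl <;> norm_num

/-- The warped product of an interval and a space form, with its projections. -/
def warpedProductMap (ε : ℤˣ) (J : TopologicalSpace.Opens ℝ) (a : ℝ → ℝ) (ha : ContDiffOn ℝ ∞ a J)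
    (hpos : ∀ t ∈ J, 0 < a t) (o : hyperquadric N l c) :
    WarpedMap (warpedModel N) (WarpedProduct J o) (Fin (N + 1) → ℝ) where
  ε := ((ε : ℤ) : ℝ)
  c := ((c : ℤ) : ℝ)
  a := a
  β := pseudoForm N (ambientIndex l c)
  t := time
  F := space
  ε_mul_self := units_cast_mul_self ε
  c_mul_self := units_cast_mul_self c
  β_symm := pseudoForm_comm N _
  contDiffAt_a p := ha.contDiffAt (J.isOpen.mem_nhds p.1.2)
  a_ne p := (hpos _ p.1.2).ne'
  contMDiff_t := contMDiff_time
  contMDiff_F := contMDiff_space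
  β_F p := p.2.1.2

variable {ε : ℤˣ} {a : ℝ → ℝ} {ha : ContDiffOn ℝ ∞ a J} {hpos : ∀ t ∈ J, 0 < a t}

theorem warpedProductMap_induces :
    (warpedProductMap ε J a ha hpos o).Induces (warpedMetric ε J a ha hpos o) :=
  fun _ _ _ => rfl

theorem warpedProductMap_submersive : (warpedProductMap ε J a ha hpos o).Submersive :=
  exists_tangent

end warped

end SemiRiemannian

end

/-- The Gauss equation of a semi-Riemannian manifold that is isometrically immersed in the warped
product of an interval and a space form. -/
theorem proposition3p2 {n N l : ℕ} (hN : 2 ≤ N) (hl : l ≤ N) (ε c : ℤˣ)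
    (o : SemiRiemannian.hyperquadric N l c)
    (J : TopologicalSpace.Opens ℝ) (hJ : IsConnected (J : Set ℝ))
    (a : ℝ → ℝ) (ha : ContDiffOn ℝ ∞ a J) (hpos : ∀ t ∈ J, 0 < a t)
    {M : Type*} [TopologicalSpace M] [T2Space M] [SecondCountableTopology M] [ConnectedSpace M]
    [ChartedSpace (EuclideanSpace ℝ (Fin n)) M] [IsManifold (𝓡 n) ∞ M]
    (g : SemiRiemannian.Metric (𝓡 n) M) (f : M → SemiRiemannian.WarpedProduct J o)
    (hf : SemiRiemannian.IsIsometricImmersion g (SemiRiemannian.warpedMetric ε J a ha hpos o) f)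
    (X Y Z W : Π p : M, TangentSpace (𝓡 n) p)
    (hX : SemiRiemannian.IsSmoothField (𝓡 n) X) (hY : SemiRiemannian.IsSmoothField (𝓡 n) Y)
    (hZ : SemiRiemannian.IsSmoothField (𝓡 n) Z) (hW : SemiRiemannian.IsSmoothField (𝓡 n) W)
    (p : M) :
    let gbar := SemiRiemannian.warpedMetric ε J a ha hpos o
    let α := SemiRiemannian.secondFundamentalForm g gbar f
    let τ : M → ℝ := fun q ↦ SemiRiemannian.time (f q)
    let T : TangentSpace (𝓡 n) p := ((ε : ℤ) : ℝ) • g.gradient τ p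
    let s : ℝ := ((ε : ℤ) : ℝ)
    let k : ℝ := ((c : ℤ) : ℝ)
    let b : ℝ := a (τ p)
    let b' : ℝ := deriv a (τ p)
    let b'' : ℝ := deriv (deriv a) (τ p)
    g.curvatureTensor X Y Z W p =
      (s * b' ^ 2 / b ^ 2 - k / b ^ 2) *
          (g.val p (X p) (Z p) * g.val p (Y p) (W p) - g.val p (Y p) (Z p) * g.val p (X p) (W p)) +
        (b'' / b - b' ^ 2 / b ^ 2 + s * k / b ^ 2) *
          (g.val p (X p) (Z p) * g.val p (Y p) T * g.val p (W p) T -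
            g.val p (Y p) (Z p) * g.val p (X p) T * g.val p (W p) T -
            g.val p (X p) (W p) * g.val p (Y p) T * g.val p (Z p) T +
            g.val p (Y p) (W p) * g.val p (X p) T * g.val p (Z p) T) -
        gbar.val (f p) (α X Z p) (α Y W p) + gbar.val (f p) (α X W p) (α Y Z p) := by
  intro gbar α τ T s k b b' b''
  -- Since T = ε grad τ, products with T are ε dτ, whereas the Gauss equation above is written with
  -- dτ.
  have hT (v : TangentSpace (𝓡 n) p) :
      g.val p v T = s * mvfderiv (𝓡 n) τ p v := by
    rw [g.symm, map_smul, smul_apply, SemiRiemannian.Metric.gradient,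
      SemiRiemannian.Metric.val_sharp, smul_eq_mul]
  have hs : s * s = 1 := SemiRiemannian.units_cast_mul_self ε
  have hind := SemiRiemannian.warpedProductMap_induces (ε := ε) (ha := ha) (hpos := hpos) (o := o)
  have hsub := SemiRiemannian.warpedProductMap_submersive (ε := ε) (ha := ha) (hpos := hpos) (o := o)
  have hgauss := (hind.comp hf).curvatureTensor_eq hX hY hZ hW p
  have h1 := hind.val_secondFundamentalForm hsub hf (X := X) (Y := Y)
    (hZ.mdifferentiableAt p) (hW.mdifferentiableAt p)
  have h2 := hind.val_secondFundamentalForm hsub hf (X := Y) (Y := X)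
    (hZ.mdifferentiableAt p) (hW.mdifferentiableAt p)
  rw [← h1, ← h2] at hgauss
  rw [gbar.symm (f p) (α X W p), hT, hT, hT, hT]
  refine hgauss.trans ?_
  change (s * b' ^ 2 / b ^ 2 - k / b ^ 2) * _ + (b'' / b - b' ^ 2 / b ^ 2 + s * k / b ^ 2) *
    (_ * mvfderiv (𝓡 n) τ p (Y p) * mvfderiv (𝓡 n) τ p (W p) -
      _ * mvfderiv (𝓡 n) τ p (X p) * mvfderiv (𝓡 n) τ p (W p) -
      _ * mvfderiv (𝓡 n) τ p (Y p) * mvfderiv (𝓡 n) τ p (Z p) +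
      _ * mvfderiv (𝓡 n) τ p (X p) * mvfderiv (𝓡 n) τ p (Z p)) -
    gbar.val (f p) (α X Z p) (α Y W p) + gbar.val (f p) (α Y Z p) (α X W p) = _
  generalize mvfderiv (𝓡 n) τ p (X p) = ξ
  generalize mvfderiv (𝓡 n) τ p (Y p) = η
  generalize mvfderiv (𝓡 n) τ p (Z p) = ζ
  generalize mvfderiv (𝓡 n) τ p (W p) = κ
  -- Each summand of the second bracket contains T twice, so the discrepancy is a factor ε² = 1.
  linear_combination -(b'' / b - b' ^ 2 / b ^ 2 + s * k / b ^ 2) *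
    (g.val p (X p) (Z p) * η * κ - g.val p (Y p) (Z p) * ξ * κ -
      g.val p (X p) (W p) * η * ζ + g.val p (Y p) (W p) * ξ * ζ) * hs
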